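/- Let $n\ge 1$ and $0<\delta<1$. For $f\in L^2(\mathbb{R}^n)$ let $\hat f(\xi)=\int_{\mathbb{R}^n}e^{-2\pi i x\cdot\xi}f(x)\,dx$ be its Fourier transform, and let $$\Sigma_\delta(\mathbb{R}^n)=\Big\{f\in L^2(\mathbb{R}^n) : \|f\|_{\Sigma_\delta}^2:=\int|x|^{2\delta}|f(x)|^2dx+\int|\xi|^{2\delta}|\hat f(\xi)|^2d\xi<\infty\Big\}.$$ Let $u$ be the solution of the Schrödinger equation $\partial_t u=\frac{i}{2}\hbar\Delta u$, $\hbar=\frac1{2\pi}$, with $u(\cdot,0)=f$, i.e. $\hat u(\xi,t)=e^{-\pi i t|\xi|^2}\hat f(\xi)$, and let $h_\delta[f](t)=\int_{\mathbb{R}^n}|x|^{2\delta}|u(x,t)|^2dx$. **Theorem.** For every $a>0$ there is a constant $C_a$, depending only on $a$, $n$ and $\delta$, such that for every $f\in\Sigma_\delta(\mathbb{R}^n)$ the following holds. The function $h_\delta[f]$ is finite everywhere and defines a tempered distribution on $\mathbb{R}$; let $\hat h_\delta$ be its Fourier transform, $\langle\hat h_\delta,\varphi\rangle=\int h_\delta[f](t)\,\hat\varphi(t)\,dt$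 for $\varphi\in\mathcal{S}(\mathbb{R})$. 1. In $\mathbb{R}\setminus\{0\}$, $$\hat h_\delta(\tau)=-2b_{n,\delta}\int_{\mathbb{R}^{2n}}\hat f(\xi)\overline{\hat f(\eta)}\,\delta_0\Big(\tau-\frac{|\eta|^2-|\xi|^2}{2}\Big)\frac{d\xi\,d\eta}{|\xi-\eta|^{n+2\delta}},\qquad b_{n,\delta}=\frac{1}{2\pi^{n/2+2\delta}}\frac{\Gamma(\frac{n+2\delta}{2})}{|\Gamma(-\delta)|},$$ where $\delta_0$ is the Dirac mass; that is, for every $\varphi\in\mathcal{S}(\mathbb{R})$ that vanishes in a neighbourhood of $0$, $$\langle\hat h_\delta,\varphi\rangle=-2b_{n,\delta}\int_{\mathbb{R}^{2n}}\hat f(\xi)\overline{\hat f(\eta)}\,\varphi\Big(\frac{|\eta|^2-|\xi|^2}{2}\Big)\frac{d\xi\,d\eta}{|\xi-\eta|^{n+2\delta}},$$ and the integral converges absolutely. 2. If $a>0$ and $\varphi\in\mathcal{S}(\mathbb{R})$ is supported outside the interval $(-a,a)$, then $|\langle\hat h_\delta,\varphi\rangle|\le C_a\|f\|_{\Sigma_\delta}^2\|\varphi\|_\infty$.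 3. In $\mathbb{R}\setminus\{0\}$ the distribution $\hat h_\delta$ is a function, integrable on $\mathbb{R}\setminus[-a,a]$ for every $a>0$, and $\|\hat h_\delta\|_{L^1(\mathbb{R}\setminus[-a,a])}\le C_a\|f\|_{\Sigma_\delta}^2$. -/

import Mathlib

open MeasureTheory FourierTransform SchwartzMap

noncomputable section

/-- Membership of `f ∈ L²(ℝⁿ)` in `Σ_δ(ℝⁿ)`: both `|x|^δ f` and `|ξ|^δ f̂` (that is, `D^δ f`, read
on the Fourier side) are square integrable. Here `𝓕 f` is the `L²` Fourier transform, normalized as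
`f̂(ξ) = ∫ e^{-2πi x·ξ} f(x) dx`. -/
def MemSigma {n : ℕ} (δ : ℝ) (f : Lp ℂ 2 (volume : Measure (EuclideanSpace ℝ (Fin n)))) : Prop :=
  Integrable (fun x : EuclideanSpace ℝ (Fin n) => ‖x‖ ^ (2 * δ) * ‖f x‖ ^ 2) ∧
    Integrable (fun ξ : EuclideanSpace ℝ (Fin n) => ‖ξ‖ ^ (2 * δ) * ‖(𝓕 f) ξ‖ ^ 2)

/-- `‖f‖²_{Σ_δ} = ‖|x|^δ f‖₂² + ‖D^δ f‖₂²`. -/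
def sigmaNormSq {n : ℕ} (δ : ℝ) (f : Lp ℂ 2 (volume : Measure (EuclideanSpace ℝ (Fin n)))) : ℝ :=
  (∫ x : EuclideanSpace ℝ (Fin n), ‖x‖ ^ (2 * δ) * ‖f x‖ ^ 2) +
    ∫ ξ : EuclideanSpace ℝ (Fin n), ‖ξ‖ ^ (2 * δ) * ‖(𝓕 f) ξ‖ ^ 2

/-- The symbol `e^{-πi t |ξ|²}` of the Schrödinger group `e^{i t ħ Δ / 2}`, `ħ = 1/(2π)`. -/
def schrodingerSymbol {n : ℕ} (t : ℝ) (ξ : EuclideanSpace ℝ (Fin n)) : ℂ :=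
  Complex.exp (((-(Real.pi * t * ‖ξ‖ ^ 2) : ℝ) : ℂ) * Complex.I)

theorem memLp_schrodingerSymbol_mul {n : ℕ} (t : ℝ)
    (g : Lp ℂ 2 (volume : Measure (EuclideanSpace ℝ (Fin n)))) :
    MemLp (fun ξ : EuclideanSpace ℝ (Fin n) => schrodingerSymbol t ξ * g ξ) 2 volume := by
  have hc : Continuous (schrodingerSymbol t : EuclideanSpace ℝ (Fin n) → ℂ) := by
    unfold schrodingerSymbol
    fun_prop
  refine (Lp.memLp g).of_le (hc.aestronglyMeasurable.mul (Lp.aestronglyMeasurable g)) ?_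
  filter_upwards with ξ
  rw [norm_mul, schrodingerSymbol, Complex.norm_exp_ofReal_mul_I, one_mul]

/-- The `L²` solution `u(·, t)` at time `t` of the Schrödinger equation `∂ₜ u = (i/2) ħ Δ u`,
`ħ = 1/(2π)`, with initial datum `u(·, 0) = f`; that is, `û(ξ, t) = e^{-πi t |ξ|²} f̂(ξ)`. -/
def schrodingerSolution {n : ℕ} (f : Lp ℂ 2 (volume : Measure (EuclideanSpace ℝ (Fin n)))) (t : ℝ) :
    Lp ℂ 2 (volume : Measure (EuclideanSpace ℝ (Fin n))) :=
  𝓕⁻ ((memLp_schrodingerSymbol_mul t (𝓕 f)).toLp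
    (fun ξ : EuclideanSpace ℝ (Fin n) => schrodingerSymbol t ξ * (𝓕 f) ξ))

/-- `h_δ[f](t) = ∫ |x|^{2δ} |u(x, t)|² dx`. -/
def hDelta {n : ℕ} (δ : ℝ) (f : Lp ℂ 2 (volume : Measure (EuclideanSpace ℝ (Fin n)))) (t : ℝ) : ℝ :=
  ∫ x : EuclideanSpace ℝ (Fin n), ‖x‖ ^ (2 * δ) * ‖schrodingerSolution f t x‖ ^ 2

/-- `b_{n,δ} = Γ((n + 2δ)/2) / (2 π^{n/2 + 2δ} |Γ(-δ)|)`. -/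
def bConst (n : ℕ) (δ : ℝ) : ℝ :=
  1 / (2 * Real.pi ^ ((n : ℝ) / 2 + 2 * δ)) *
    (Real.Gamma (((n : ℝ) + 2 * δ) / 2) / |Real.Gamma (-δ)|)

/-- The integrand, as a function of `(ξ, η)`, obtained when
`f̂(ξ) conj(f̂(η)) δ₀(τ - (|η|² - |ξ|²)/2) |ξ - η|^{-n-2δ}` is paired in `τ` with `φ`. -/
def hFourierIntegrand {n : ℕ} (δ : ℝ)
    (f : Lp ℂ 2 (volume : Measure (EuclideanSpace ℝ (Fin n)))) (φ : ℝ → ℂ)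
    (p : EuclideanSpace ℝ (Fin n) × EuclideanSpace ℝ (Fin n)) : ℂ :=
  (𝓕 f) p.1 * (starRingEnd ℂ) ((𝓕 f) p.2) * φ ((‖p.2‖ ^ 2 - ‖p.1‖ ^ 2) / 2) /
    ((‖p.1 - p.2‖ ^ ((n : ℝ) + 2 * δ) : ℝ) : ℂ)

/-- `H` is the tempered distribution `φ ↦ ∫ h φ` given by the function `h`, all of these integrals
being absolutely convergent. -/
def IsDistributionOf (h : ℝ → ℝ) (H : 𝓢'(ℝ, ℂ)) : Prop :=
  ∀ φ : 𝓢(ℝ, ℂ), Integrable (fun t : ℝ => (h t : ℂ) * φ t) ∧ H φ = ∫ t : ℝ, (h t : ℂ) * φ t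

end

/-! On the Fourier side the weight `|x|^{2δ}` becomes a Gagliardo seminorm: Plancherel applied to
`g(· + ζ) - g`, integrated against `|ζ|^{-n-2δ}`, shows that `b_{n,δ} ∬ |g(ξ) - g(η)|² |ξ -
η|^{-n-2δ}` equals `∫ |x|^{2δ} |𝓕⁻ g|²` (`lintegral_gagliardo`). With `g = e^{-πit|·|²} f̂` this is
a formula for `h_δ[f](t)` in which time enters only through unimodular phases.

Expand the square. The diagonal terms do not depend on `t`, so their Fourier transform lives at `τ =
0`; the two cross terms oscillate at the frequencies `±(|η|² - |ξ|²)/2` and are exchanged by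
swapping `ξ` and `η`, whence the factor `-2b`. The terms cannot be integrated separately over `(ξ,
η)`, because the kernel is singular on the diagonal. Hence Fubini is applied to the whole
nonnegative energy, and the square is expanded only inside the `t`-integral at fixed `(ξ, η)`, where
`φ(0) = 0` removes the diagonal terms (`integral_gagliardoEnergy_mul_fourier`,
`integral_hDelta_mul_fourier`).

One estimate supplies both the convergence and the bounds. Put `s = (1 + |ξ|)|ξ - η|`. The energy
gap satisfies `||η|² - |ξ|²| ≤ 2s + s²`, so a gap bounded below forces `s` to be bounded below, and
the kernel is then dominated by `min(1, s²)|ξ - η|^{-n-2δ}`. By scaling, the `η`-integral of the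
latter is a constant times `(1 + |ξ|)^{2δ}`, which the `Σ_δ` norm of `f` controls
(`exists_lintegral_truncatedKernel_le`, `exists_lintegral_pairDensity_le`). The same truncated
kernel bounds the differences of the phases and yields `h_δ[f](t) = O((1 + |t|)²)`, hence a tempered
distribution.

Finally, away from `0` the transform is the image of a complex density under the energy gap. That
map pulls Lebesgue null sets back to null sets (`map_energyGap_absolutelyContinuous`), so
Radon–Nikodym turns the image into a function. -/

/-! ### Gamma integrals with values in `[0, ∞]`. -/

/-- A Bochner integral is `0` by convention when the integrand is not integrable, so a nonzero value
already certifies integrability. -/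
theorem lintegral_ofReal_eq_of_integral_ne_zero {α : Type*} [MeasurableSpace α] {μ : Measure α}
    {f : α → ℝ} {c : ℝ} (hf : 0 ≤ᵐ[μ] f) (h : ∫ x, f x ∂μ = c) (hc : c ≠ 0) :
    ∫⁻ x, ENNReal.ofReal (f x) ∂μ = ENNReal.ofReal c := by
  have hi : Integrable f μ := Integrable.of_integral_ne_zero (by rwa [h])
  rw [← h, ofReal_integral_eq_lintegral_ofReal hi hf]

theorem lintegral_rpow_mul_exp_neg_mul {p b : ℝ} (hp : 0 < p) (hb : 0 < b) :
    ∫⁻ s in Set.Ioi (0 : ℝ), ENNReal.ofReal (s ^ (p - 1) * Real.exp (-b * s)) =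
      ENNReal.ofReal (b ^ (-p) * Real.Gamma p) := by
  refine lintegral_ofReal_eq_of_integral_ne_zero ?_ ?_ ?_
  · filter_upwards [ae_restrict_mem measurableSet_Ioi] with s hs
    have : 0 < s := hs
    simp only [Pi.zero_apply]
    positivity
  · have := integral_rpow_mul_exp_neg_mul_rpow (p := 1) (q := p - 1) (b := b) one_pos
      (by linarith) hb
    simpa using this
  · have := Real.Gamma_pos_of_pos hp
    positivity

/-- The Gamma integral after `s ↦ 1/s`. It writes `b^{-p}` as a superposition of Gaussians when `b =
|z|²`. -/
theorem lintegral_rpow_mul_exp_neg_div {p b : ℝ} (hp : 0 < p) (hb : 0 < b) :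
    ∫⁻ s in Set.Ioi (0 : ℝ), ENNReal.ofReal (s ^ (-p - 1) * Real.exp (-b / s)) =
      ENNReal.ofReal (b ^ (-p) * Real.Gamma p) := by
  refine lintegral_ofReal_eq_of_integral_ne_zero ?_ ?_ ?_
  · filter_upwards [ae_restrict_mem measurableSet_Ioi] with s hs
    have : 0 < s := hs
    simp only [Pi.zero_apply]
    positivity
  · have h := integral_rpow_mul_exp_neg_mul_rpow (p := 1) (q := p - 1) (b := b) one_pos
      (by linarith) hb
    rw [← integral_comp_rpow_Ioi _ (p := -1) (by norm_num)] at h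
    have h2 : b ^ (-(p - 1 + 1) / 1) * (1 / 1) * Real.Gamma ((p - 1 + 1) / 1) =
      b ^ (-p) * Real.Gamma p := by simp
    rw [h2] at h
    rw [← h]
    refine setIntegral_congr_fun measurableSet_Ioi fun s hs => ?_
    have hs : 0 < s := hs
    simp only [smul_eq_mul, abs_neg, abs_one, one_mul, Real.rpow_one]
    rw [← Real.rpow_mul hs.le, ← mul_assoc, ← Real.rpow_add hs, Real.rpow_neg_one, div_eq_mul_inv]
    congr 2
    ring
  · have := Real.Gamma_pos_of_pos hp
    positivity

/-- Write `1 - e^{-As}` as `∫₀^A s e^{-vs} dv` and exchange the integrals: the inner one is `Γ(1 -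
δ) v^{δ-1}`, which is integrable at `0` because `δ > 0`. -/
theorem lintegral_rpow_mul_one_sub_exp {δ A : ℝ} (hδ0 : 0 < δ) (hδ1 : δ < 1) (hA : 0 ≤ A) :
    ∫⁻ s in Set.Ioi (0 : ℝ), ENNReal.ofReal (s ^ (-δ - 1) * (1 - Real.exp (-A * s))) =
      ENNReal.ofReal (A ^ δ * (Real.Gamma (1 - δ) / δ)) := by
  have hG : 0 < Real.Gamma (1 - δ) := Real.Gamma_pos_of_pos (by linarith)
  have h1 : ∀ s ∈ Set.Ioi (0 : ℝ),
      ENNReal.ofReal (s ^ (-δ - 1) * (1 - Real.exp (-A * s))) =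
      ∫⁻ v in Set.Ioc 0 A, ENNReal.ofReal (s ^ (-δ) * Real.exp (-v * s)) := by
    intro s hs
    have hs : 0 < s := hs
    have e : ∫ v in Set.Ioc 0 A, s ^ (-δ) * Real.exp (-v * s) =
        s ^ (-δ - 1) * (1 - Real.exp (-A * s)) := by
      rw [← intervalIntegral.integral_of_le hA]
      have hd : ∀ v ∈ Set.uIcc 0 A, HasDerivAt (fun v => -(s ^ (-δ - 1) * Real.exp (-v * s)))
          (s ^ (-δ) * Real.exp (-v * s)) v := by
        intro v _
        have h := ((((hasDerivAt_id v).neg.mul_const s).exp).const_mul (s ^ (-δ - 1))).neg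
        have : s ^ (-δ) = s ^ (-δ - 1) * s := by
          rw [← Real.rpow_add_one hs.ne']; congr 1; ring
        rw [this]
        convert! h using 1
        simp only [Pi.neg_apply, id_eq]
        ring
      rw [intervalIntegral.integral_eq_sub_of_hasDerivAt hd
        (Continuous.intervalIntegrable (by fun_prop) _ _)]
      simp
      ring
    rw [← e, ofReal_integral_eq_lintegral_ofReal]
    · exact (Continuous.integrableOn_Icc (by fun_prop)).mono_set Set.Ioc_subset_Icc_self
    · filter_upwards with v
      simp only [Pi.zero_apply]
      positivity
  rw [setLIntegral_congr_fun measurableSet_Ioi h1, lintegral_lintegral_swap (by fun_prop)]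
  have h2 : ∀ v ∈ Set.Ioc 0 A,
      ∫⁻ s in Set.Ioi (0 : ℝ), ENNReal.ofReal (s ^ (-δ) * Real.exp (-v * s)) =
      ENNReal.ofReal (v ^ (δ - 1) * Real.Gamma (1 - δ)) := by
    intro v hv
    have := lintegral_rpow_mul_exp_neg_mul (p := 1 - δ) (b := v) (by linarith) hv.1
    simpa using this
  rw [setLIntegral_congr_fun measurableSet_Ioc h2, ← ofReal_integral_eq_lintegral_ofReal]
  · rw [← intervalIntegral.integral_of_le hA, intervalIntegral.integral_mul_const,
      integral_rpow (Or.inl (by linarith))]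
    congr 1
    rw [sub_add_cancel, Real.zero_rpow hδ0.ne']
    ring
  · have := (intervalIntegral.intervalIntegrable_rpow' (a := 0) (b := A) (r := δ - 1)
      (by linarith)).mul_const (Real.Gamma (1 - δ))
    exact (intervalIntegrable_iff_integrableOn_Ioc_of_le hA).1 this
  · filter_upwards [ae_restrict_mem measurableSet_Ioc] with v hv
    have := hv.1
    simp only [Pi.zero_apply]
    positivity

/-! ### The constant `b_{n,δ}`, by Gaussian subordination. -/

section Euclidean

variable {n : ℕ}

theorem lintegral_one_sub_cos_mul_exp {s : ℝ} (hs : 0 < s) (x : EuclideanSpace ℝ (Fin n)) :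
    ∫⁻ z : EuclideanSpace ℝ (Fin n),
      ENNReal.ofReal ((1 - Real.cos (2 * Real.pi * inner ℝ x z)) * Real.exp (-‖z‖ ^ 2 / s)) =
    ENNReal.ofReal ((Real.pi * s) ^ ((n : ℝ) / 2) *
      (1 - Real.exp (-(Real.pi ^ 2 * ‖x‖ ^ 2) * s))) := by
  have hb : 0 < ((1 / s : ℝ) : ℂ).re := by simpa using hs
  have hfac : ∀ y : EuclideanSpace ℝ (Fin n),
      ∫ z : EuclideanSpace ℝ (Fin n), Complex.exp (-((1 / s : ℝ) : ℂ) * ‖z‖ ^ 2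
        + (2 * Real.pi * Complex.I) * (inner ℝ y z : ℝ)) =
      (((Real.pi * s) ^ ((n : ℝ) / 2) * Real.exp (-(Real.pi ^ 2 * ‖y‖ ^ 2) * s) : ℝ) : ℂ) := by
    intro y
    rw [GaussianFourier.integral_cexp_neg_mul_sq_norm_add hb]
    rw [finrank_euclideanSpace_fin]
    push_cast
    rw [Complex.ofReal_cpow (by positivity)]
    congr 1
    · push_cast
      congr 1
      field_simp
    · congr 1
      have : (s : ℂ) ≠ 0 := by exact_mod_cast hs.ne'
      rw [mul_pow, Complex.I_sq]
      field_simp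
      ring
  -- The explicit value is nonzero, which gives integrability of the complex Gaussian without a
  -- separate estimate.
  have hne : ∀ y : EuclideanSpace ℝ (Fin n),
      (((Real.pi * s) ^ ((n : ℝ) / 2) * Real.exp (-(Real.pi ^ 2 * ‖y‖ ^ 2) * s) : ℝ) : ℂ) ≠ 0 := by
    intro y
    rw [Complex.ofReal_ne_zero]
    have := Real.pi_pos
    positivity
  have hint : ∀ y : EuclideanSpace ℝ (Fin n),
      Integrable fun z : EuclideanSpace ℝ (Fin n) => Complex.exp (-((1 / s : ℝ) : ℂ) * ‖z‖ ^ 2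
        + (2 * Real.pi * Complex.I) * (inner ℝ y z : ℝ)) := fun y =>
    Integrable.of_integral_ne_zero (by rw [hfac y]; exact hne y)
  have hre : ∀ y z : EuclideanSpace ℝ (Fin n), (Complex.exp (-((1 / s : ℝ) : ℂ) * ‖z‖ ^ 2
        + (2 * Real.pi * Complex.I) * (inner ℝ y z : ℝ))).re =
      Real.cos (2 * Real.pi * inner ℝ y z) * Real.exp (-‖z‖ ^ 2 / s) := by
    intro y z
    have : (-((1 / s : ℝ) : ℂ) * ‖z‖ ^ 2 + (2 * Real.pi * Complex.I) * (inner ℝ y z : ℝ)) =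
      ((-‖z‖ ^ 2 / s : ℝ) : ℂ) + ((2 * Real.pi * inner ℝ y z : ℝ) : ℂ) * Complex.I := by
      push_cast; ring
    rw [this, Complex.exp_add, ← Complex.ofReal_exp, Complex.re_ofReal_mul,
      Complex.exp_ofReal_mul_I_re, mul_comm]
  have hI : ∀ y : EuclideanSpace ℝ (Fin n), Integrable fun z : EuclideanSpace ℝ (Fin n) =>
      Real.cos (2 * Real.pi * inner ℝ y z) * Real.exp (-‖z‖ ^ 2 / s) := fun y => by
    have := (hint y).re
    simp only [RCLike.re_to_complex, hre] at this
    exact this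
  have hV : ∀ y : EuclideanSpace ℝ (Fin n), ∫ z : EuclideanSpace ℝ (Fin n),
      Real.cos (2 * Real.pi * inner ℝ y z) * Real.exp (-‖z‖ ^ 2 / s) =
      (Real.pi * s) ^ ((n : ℝ) / 2) * Real.exp (-(Real.pi ^ 2 * ‖y‖ ^ 2) * s) := fun y => by
    simp only [← hre]
    have := integral_re (hint y)
    simp only [RCLike.re_to_complex] at this
    rw [this, hfac, Complex.ofReal_re]
  rw [← ofReal_integral_eq_lintegral_ofReal]
  · congr 1
    -- The constant `1` is the cosine at frequency `0`, so one Gaussian formula evaluates both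
    -- terms.
    have e : ∀ z : EuclideanSpace ℝ (Fin n),
        (1 - Real.cos (2 * Real.pi * inner ℝ x z)) * Real.exp (-‖z‖ ^ 2 / s) =
        Real.cos (2 * Real.pi * inner ℝ 0 z) * Real.exp (-‖z‖ ^ 2 / s) -
        Real.cos (2 * Real.pi * inner ℝ x z) * Real.exp (-‖z‖ ^ 2 / s) := by
      intro z; simp; ring
    simp only [e]
    rw [integral_sub (hI 0) (hI x), hV, hV]
    simp
    ring
  · have e : ∀ z : EuclideanSpace ℝ (Fin n),
        (1 - Real.cos (2 * Real.pi * inner ℝ x z)) * Real.exp (-‖z‖ ^ 2 / s) =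
        Real.cos (2 * Real.pi * inner ℝ 0 z) * Real.exp (-‖z‖ ^ 2 / s) -
        Real.cos (2 * Real.pi * inner ℝ x z) * Real.exp (-‖z‖ ^ 2 / s) := by
      intro z; simp; ring
    simp only [e]
    exact (hI 0).sub (hI x)
  · filter_upwards with z
    have := Real.cos_le_one (2 * Real.pi * inner ℝ x z)
    simp only [Pi.zero_apply]
    exact mul_nonneg (by linarith) (Real.exp_pos _).le

/-- The Gagliardo kernel `|z|^{-n-2δ}`. -/
noncomputable def gagliardoKernel (δ : ℝ) (z : EuclideanSpace ℝ (Fin n)) : ℝ :=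
  (‖z‖ ^ ((n : ℝ) + 2 * δ))⁻¹

theorem gagliardoKernel_nonneg (δ : ℝ) (z : EuclideanSpace ℝ (Fin n)) :
    0 ≤ gagliardoKernel δ z := by
  unfold gagliardoKernel; positivity

@[fun_prop]
theorem measurable_gagliardoKernel (δ : ℝ) :
    Measurable (gagliardoKernel δ : EuclideanSpace ℝ (Fin n) → ℝ) := by
  unfold gagliardoKernel; fun_prop

theorem gagliardoKernel_neg (δ : ℝ) (z : EuclideanSpace ℝ (Fin n)) :
    gagliardoKernel δ (-z) = gagliardoKernel δ z := by
  simp [gagliardoKernel]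

theorem bConst_pos {δ : ℝ} (hδ0 : 0 < δ) (hδ1 : δ < 1) : 0 < bConst n δ := by
  unfold bConst
  have h1 : 0 < Real.Gamma (((n : ℝ) + 2 * δ) / 2) := Real.Gamma_pos_of_pos (by positivity)
  have h2 : 0 < |Real.Gamma (-δ)| := by
    rw [abs_pos]
    refine Real.Gamma_ne_zero fun m hm => ?_
    have : (m : ℝ) = δ := by linarith
    rcases Nat.eq_zero_or_pos m with h | h
    · subst h; simp at this; linarith
    · have : (1 : ℝ) ≤ m := by exact_mod_cast h
      linarith
  have := Real.pi_pos
  positivity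

theorem Gamma_one_sub_div {δ : ℝ} (hδ0 : 0 < δ) (hδ1 : δ < 1) :
    Real.Gamma (1 - δ) / δ = |Real.Gamma (-δ)| := by
  have h : Real.Gamma (-δ + 1) = -δ * Real.Gamma (-δ) := Real.Gamma_add_one (by linarith)
  have hG : 0 < Real.Gamma (1 - δ) := Real.Gamma_pos_of_pos (by linarith)
  rw [show -δ + 1 = 1 - δ by ring] at h
  have h2 : Real.Gamma (-δ) < 0 := by
    by_contra! h3
    nlinarith
  rw [abs_of_neg h2, h]
  field_simp

/-- With `p = (n + 2δ)/2`, the kernel is `Γ(p)⁻¹ ∫ s^{-p-1} e^{-|z|²/s} ds`. All integrands are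
nonnegative, so Tonelli allows integrating in `z` first, which is Gaussian, and then in `s`. Keeping
the constants exact produces `b_{n,δ}`. -/
theorem lintegral_one_sub_cos_mul_gagliardoKernel {δ : ℝ} (hδ0 : 0 < δ) (hδ1 : δ < 1)
    (hn : 1 ≤ n) (x : EuclideanSpace ℝ (Fin n)) :
    ∫⁻ z : EuclideanSpace ℝ (Fin n),
      ENNReal.ofReal (2 * (1 - Real.cos (2 * Real.pi * inner ℝ x z)) * gagliardoKernel δ z) =
    ENNReal.ofReal ((bConst n δ)⁻¹ * ‖x‖ ^ (2 * δ)) := by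
  set p : ℝ := ((n : ℝ) + 2 * δ) / 2 with hp
  have hp0 : 0 < p := by positivity
  have hG : 0 < Real.Gamma p := Real.Gamma_pos_of_pos hp0
  have : Nonempty (Fin n) := ⟨⟨0, hn⟩⟩
  have h1 : ∀ z : EuclideanSpace ℝ (Fin n), z ≠ 0 →
      ENNReal.ofReal (2 * (1 - Real.cos (2 * Real.pi * inner ℝ x z)) * gagliardoKernel δ z) =
      ENNReal.ofReal (2 / Real.Gamma p) * ∫⁻ s in Set.Ioi (0 : ℝ),
        ENNReal.ofReal (s ^ (-p - 1)) *
        ENNReal.ofReal ((1 - Real.cos (2 * Real.pi * inner ℝ x z)) * Real.exp (-‖z‖ ^ 2 / s)) := by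
    intro z hz
    have hz' : 0 < ‖z‖ := norm_pos_iff.2 hz
    have hc : 0 ≤ 1 - Real.cos (2 * Real.pi * inner ℝ x z) := by
      linarith [Real.cos_le_one (2 * Real.pi * inner ℝ x z)]
    have e : ∀ s ∈ Set.Ioi (0 : ℝ), ENNReal.ofReal (s ^ (-p - 1)) *
        ENNReal.ofReal ((1 - Real.cos (2 * Real.pi * inner ℝ x z)) * Real.exp (-‖z‖ ^ 2 / s)) =
        ENNReal.ofReal (1 - Real.cos (2 * Real.pi * inner ℝ x z)) *
        ENNReal.ofReal (s ^ (-p - 1) * Real.exp (-‖z‖ ^ 2 / s)) := by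
      intro s hs
      have hs : 0 < s := hs
      rw [← ENNReal.ofReal_mul (by positivity), ← ENNReal.ofReal_mul hc]
      congr 1; ring
    rw [setLIntegral_congr_fun measurableSet_Ioi e, lintegral_const_mul _ (by fun_prop),
      lintegral_rpow_mul_exp_neg_div hp0 (by positivity), ← ENNReal.ofReal_mul hc,
      ← ENNReal.ofReal_mul (by positivity)]
    congr 1
    have : (‖z‖ ^ 2) ^ (-p) = (‖z‖ ^ ((n : ℝ) + 2 * δ))⁻¹ := by
      rw [← Real.rpow_natCast, ← Real.rpow_mul hz'.le, ← Real.rpow_neg hz'.le]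
      congr 1
      push_cast
      rw [hp]; ring
    rw [gagliardoKernel, this]
    field_simp
  -- The origin is negligible because `n ≥ 1`; in dimension `0` it would carry all the mass.
  have h0 : ∀ᵐ z : EuclideanSpace ℝ (Fin n), z ≠ 0 := by
    simp [ae_iff, measure_singleton]
  rw [lintegral_congr_ae (h0.mono h1), lintegral_const_mul' _ _ ENNReal.ofReal_ne_top,
    lintegral_lintegral_swap (by fun_prop)]
  have h2 : ∀ s ∈ Set.Ioi (0 : ℝ), ∫⁻ z : EuclideanSpace ℝ (Fin n),
      ENNReal.ofReal (s ^ (-p - 1)) *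
        ENNReal.ofReal ((1 - Real.cos (2 * Real.pi * inner ℝ x z)) * Real.exp (-‖z‖ ^ 2 / s)) =
      ENNReal.ofReal (Real.pi ^ ((n : ℝ) / 2)) * ENNReal.ofReal (s ^ (-δ - 1) *
      (1 - Real.exp (-(Real.pi ^ 2 * ‖x‖ ^ 2) * s))) := by
    intro s hs
    have hs : 0 < s := hs
    rw [lintegral_const_mul _ (by fun_prop), lintegral_one_sub_cos_mul_exp hs,
      ← ENNReal.ofReal_mul (by positivity), ← ENNReal.ofReal_mul (by positivity),
      Real.mul_rpow (by positivity) hs.le]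
    congr 1
    have : s ^ (-δ - 1) = s ^ (-p - 1) * s ^ ((n : ℝ) / 2) := by
      rw [← Real.rpow_add hs]; congr 1; rw [hp]; ring
    rw [this]; ring
  rw [setLIntegral_congr_fun measurableSet_Ioi h2, lintegral_const_mul _ (by fun_prop),
    lintegral_rpow_mul_one_sub_exp hδ0 hδ1 (by positivity), ← ENNReal.ofReal_mul (by positivity),
    ← ENNReal.ofReal_mul (by positivity), Gamma_one_sub_div hδ0 hδ1]
  congr 1
  have e1 : (Real.pi ^ 2 * ‖x‖ ^ 2) ^ δ = Real.pi ^ (2 * δ) * ‖x‖ ^ (2 * δ) := by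
    rw [Real.mul_rpow (by positivity) (by positivity), ← Real.rpow_natCast, ← Real.rpow_natCast,
      ← Real.rpow_mul (by positivity), ← Real.rpow_mul (by positivity)]
    norm_num
  rw [e1, bConst, ← hp, Real.rpow_add Real.pi_pos]
  have h3 := Real.pi_pos
  have h4 : 0 < |Real.Gamma (-δ)| := by
    rw [← Gamma_one_sub_div hδ0 hδ1]
    exact div_pos (Real.Gamma_pos_of_pos (by linarith)) hδ0
  field_simp

theorem norm_exp_mul_I_sub_one_sq (θ : ℝ) :
    ‖Complex.exp (θ * Complex.I) - 1‖ ^ 2 = 2 * (1 - Real.cos θ) := by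
  rw [← Complex.normSq_eq_norm_sq, Complex.normSq_apply]
  simp only [Complex.sub_re, Complex.exp_ofReal_mul_I_re, Complex.one_re, Complex.sub_im,
    Complex.exp_ofReal_mul_I_im, Complex.one_im]
  nlinarith [Real.sin_sq_add_cos_sq θ]

end Euclidean

/-! ### Plancherel for translates and the Gagliardo identity. -/

section Plancherel

variable {n : ℕ}

theorem memLp_top_exp_inner (ζ : EuclideanSpace ℝ (Fin n)) :
    MemLp (fun x : EuclideanSpace ℝ (Fin n) =>
      Complex.exp (((-(2 * Real.pi * inner ℝ ζ x) : ℝ) : ℂ) * Complex.I)) ⊤ volume := by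
  refine memLp_top_of_bound (Continuous.aestronglyMeasurable (by fun_prop)) 1 ?_
  filter_upwards with x
  rw [Complex.norm_exp_ofReal_mul_I]

/-- Modulation `u ↦ e^{-2πi ζ·x} u` on `L²`. -/
noncomputable def modulation (ζ : EuclideanSpace ℝ (Fin n)) :
    Lp ℂ 2 (volume : Measure (EuclideanSpace ℝ (Fin n))) →L[ℂ]
      Lp ℂ 2 (volume : Measure (EuclideanSpace ℝ (Fin n))) :=
  (ContinuousLinearMap.mul ℂ ℂ).holderL volume ⊤ 2 2 ((memLp_top_exp_inner ζ).toLp _)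

theorem coeFn_modulation (ζ : EuclideanSpace ℝ (Fin n))
    (u : Lp ℂ 2 (volume : Measure (EuclideanSpace ℝ (Fin n)))) :
    modulation ζ u =ᵐ[volume] fun x =>
      Complex.exp (((-(2 * Real.pi * inner ℝ ζ x) : ℝ) : ℂ) * Complex.I) * u x := by
  have h := (ContinuousLinearMap.mul ℂ ℂ).coeFn_holder (μ := volume) (r := 2)
    ((memLp_top_exp_inner ζ).toLp _) u
  filter_upwards [h, (memLp_top_exp_inner ζ).coeFn_toLp] with x hx hx2
  rw [modulation, ContinuousLinearMap.holderL_apply_apply, hx, hx2]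
  rfl

/-- Translation `g ↦ g(· + ζ)` on `L²`. -/
noncomputable def translation (ζ : EuclideanSpace ℝ (Fin n)) :
    Lp ℂ 2 (volume : Measure (EuclideanSpace ℝ (Fin n))) →
      Lp ℂ 2 (volume : Measure (EuclideanSpace ℝ (Fin n))) :=
  Lp.compMeasurePreserving (fun x => x + ζ) (measurePreserving_add_right volume ζ)

theorem coeFn_translation (ζ : EuclideanSpace ℝ (Fin n))
    (u : Lp ℂ 2 (volume : Measure (EuclideanSpace ℝ (Fin n)))) :
    translation ζ u =ᵐ[volume] fun x => u (x + ζ) :=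
  Lp.coeFn_compMeasurePreserving u _

/-- Both sides are continuous in `g` for the `L²` norm, so it is enough to treat Schwartz functions,
where the identity is a change of variables in the integral. -/
theorem fourierInv_translation (ζ : EuclideanSpace ℝ (Fin n))
    (g : Lp ℂ 2 (volume : Measure (EuclideanSpace ℝ (Fin n)))) :
    𝓕⁻ (translation ζ g) = modulation ζ (𝓕⁻ g) := by
  refine DenseRange.induction_on
    (p := fun g : Lp ℂ 2 (volume : Measure (EuclideanSpace ℝ (Fin n))) =>
      𝓕⁻ (translation ζ g) = modulation ζ (𝓕⁻ g))
    (SchwartzMap.denseRange_toLpCLM (p := 2) ENNReal.ofNat_ne_top) g ?_ ?_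
  · refine isClosed_eq ?_ ?_
    · exact (Lp.fourierTransformₗᵢ (EuclideanSpace ℝ (Fin n)) ℂ).symm.continuous.comp
        (Lp.isometry_compMeasurePreserving _).continuous
    · exact (modulation ζ).continuous.comp
        (Lp.fourierTransformₗᵢ (EuclideanSpace ℝ (Fin n)) ℂ).symm.continuous
  · intro φ
    simp only [toLpCLM_apply]
    have h1 : translation ζ (φ.toLp 2) = (compSubConstCLM ℂ (-ζ) φ).toLp 2 := by
      refine Lp.ext ?_
      filter_upwards [coeFn_translation ζ (φ.toLp 2), (compSubConstCLM ℂ (-ζ) φ).coeFn_toLp 2,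
        (measurePreserving_add_right volume ζ).quasiMeasurePreserving.ae
          (φ.coeFn_toLp 2 volume)]
        with x h1 h2 h3
      rw [h1, h2, h3]
      simp
    rw [h1, toLp_fourierInv_eq, toLp_fourierInv_eq]
    refine Lp.ext ?_
    filter_upwards [coeFn_modulation ζ ((𝓕⁻ φ).toLp 2),
      (𝓕⁻ (compSubConstCLM ℂ (-ζ) φ)).coeFn_toLp 2, (𝓕⁻ φ).coeFn_toLp 2] with x h1 h2 h3
    rw [h1, h2, h3, fourierInv_coe, fourierInv_coe, Real.fourierInv_eq', Real.fourierInv_eq',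
      ← integral_add_right_eq_self (fun v => Complex.exp (((2 * Real.pi * inner ℝ v x : ℝ) : ℂ)
        * Complex.I) • φ v) ζ, ← integral_const_mul]
    refine integral_congr_ae (Filter.Eventually.of_forall fun v => ?_)
    simp only [compSubConstCLM_apply, sub_neg_eq_add, smul_eq_mul]
    rw [← mul_assoc, ← Complex.exp_add, inner_add_left]
    congr 2
    push_cast
    ring

theorem enorm_sq_eq_lintegral (u : Lp ℂ 2 (volume : Measure (EuclideanSpace ℝ (Fin n)))) :
    ‖u‖ₑ ^ 2 = ∫⁻ x, ‖u x‖ₑ ^ 2 := by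
  have h := eLpNorm_nnreal_pow_eq_lintegral (μ := volume) (f := u) (p := 2) two_ne_zero
  rw [Lp.enorm_def]
  simpa using h

/-- The inverse Fourier transform is an isometry and turns the difference into multiplication by
`e^{-2πi ζ·x} - 1`, whose squared modulus is `2(1 - cos(2π x·ζ))`. -/
theorem lintegral_enorm_translation_sub (ζ : EuclideanSpace ℝ (Fin n))
    (g : Lp ℂ 2 (volume : Measure (EuclideanSpace ℝ (Fin n)))) :
    ∫⁻ ξ, ‖g (ξ + ζ) - g ξ‖ₑ ^ 2 =
      ∫⁻ x, ENNReal.ofReal (2 * (1 - Real.cos (2 * Real.pi * inner ℝ x ζ))) * ‖(𝓕⁻ g) x‖ₑ ^ 2 := by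
  have h1 : ∫⁻ ξ, ‖g (ξ + ζ) - g ξ‖ₑ ^ 2 = ‖translation ζ g - g‖ₑ ^ 2 := by
    rw [enorm_sq_eq_lintegral]
    refine lintegral_congr_ae ?_
    filter_upwards [coeFn_translation ζ g, Lp.coeFn_sub (translation ζ g) g] with x h1 h2
    rw [h2, Pi.sub_apply, h1]
  have h2 : ‖translation ζ g - g‖ₑ = ‖modulation ζ (𝓕⁻ g) - 𝓕⁻ g‖ₑ := by
    rw [← fourierInv_translation]
    have h3 : ‖(Lp.fourierTransformₗᵢ (EuclideanSpace ℝ (Fin n)) ℂ).symm (translation ζ g - g)‖ₑ =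
      ‖translation ζ g - g‖ₑ := LinearIsometryEquiv.enorm_map _ _
    rw [← h3, map_sub]
    rfl
  rw [h1, h2, enorm_sq_eq_lintegral]
  refine lintegral_congr_ae ?_
  filter_upwards [coeFn_modulation ζ (𝓕⁻ g), Lp.coeFn_sub (modulation ζ (𝓕⁻ g)) (𝓕⁻ g)] with x h1 h2
  rw [h2, Pi.sub_apply, h1, ← sub_one_mul, enorm_mul, mul_pow]
  congr 1
  rw [← Real.cos_neg, real_inner_comm, ← norm_exp_mul_I_sub_one_sq, ENNReal.ofReal_pow (norm_nonneg _),
    ofReal_norm]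

theorem measurable_coeFn_Lp (g : Lp ℂ 2 (volume : Measure (EuclideanSpace ℝ (Fin n)))) :
    Measurable g := (Lp.stronglyMeasurable g).measurable

/-- Substitute `ξ = η + ζ`, use Plancherel in `η` for each fixed `ζ`, then integrate the multiplier
in `ζ`. The identity holds in `[0, ∞]`, so it also transfers finiteness from one side to the other.
-/
theorem lintegral_gagliardo {δ : ℝ} (hδ0 : 0 < δ) (hδ1 : δ < 1) (hn : 1 ≤ n)
    (g : Lp ℂ 2 (volume : Measure (EuclideanSpace ℝ (Fin n)))) :
    ∫⁻ p : EuclideanSpace ℝ (Fin n) × EuclideanSpace ℝ (Fin n),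
      ‖g p.1 - g p.2‖ₑ ^ 2 * ENNReal.ofReal (gagliardoKernel δ (p.1 - p.2)) =
    ENNReal.ofReal (bConst n δ)⁻¹ *
      ∫⁻ x, ENNReal.ofReal (‖x‖ ^ (2 * δ)) * ‖(𝓕⁻ g) x‖ₑ ^ 2 := by
  have hg := measurable_coeFn_Lp g
  have hu := measurable_coeFn_Lp (𝓕⁻ g)
  have hb := bConst_pos (n := n) hδ0 hδ1
  rw [Measure.volume_eq_prod, lintegral_prod_symm _ (by fun_prop)]
  have h1 : ∀ η : EuclideanSpace ℝ (Fin n),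
      ∫⁻ ξ, ‖g ξ - g η‖ₑ ^ 2 * ENNReal.ofReal (gagliardoKernel δ (ξ - η)) =
      ∫⁻ ζ, ‖g (η + ζ) - g η‖ₑ ^ 2 * ENNReal.ofReal (gagliardoKernel δ ζ) := by
    intro η
    rw [← lintegral_add_left_eq_self _ η]
    simp
  simp only [h1]
  rw [lintegral_lintegral_swap (by fun_prop)]
  have h2 : ∀ ζ : EuclideanSpace ℝ (Fin n),
      ∫⁻ η, ‖g (η + ζ) - g η‖ₑ ^ 2 * ENNReal.ofReal (gagliardoKernel δ ζ) =
      ∫⁻ x, ENNReal.ofReal (2 * (1 - Real.cos (2 * Real.pi * inner ℝ x ζ)) *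
        gagliardoKernel δ ζ) * ‖(𝓕⁻ g) x‖ₑ ^ 2 := by
    intro ζ
    rw [lintegral_mul_const _ (by fun_prop), lintegral_enorm_translation_sub,
      ← lintegral_mul_const _ (by fun_prop)]
    refine lintegral_congr fun x => ?_
    have : 0 ≤ 1 - Real.cos (2 * Real.pi * inner ℝ x ζ) := by
      linarith [Real.cos_le_one (2 * Real.pi * inner ℝ x ζ)]
    rw [ENNReal.ofReal_mul (p := 2 * (1 - Real.cos (2 * Real.pi * inner ℝ x ζ))) (by positivity)]
    ring
  simp only [h2]
  rw [lintegral_lintegral_swap (by fun_prop)]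
  rw [← lintegral_const_mul _ (by fun_prop)]
  refine lintegral_congr fun x => ?_
  rw [lintegral_mul_const _ (by fun_prop), lintegral_one_sub_cos_mul_gagliardoKernel hδ0 hδ1 hn,
    ENNReal.ofReal_mul (by positivity), mul_assoc]

end Plancherel

/-! ### The truncated kernel and its control by the `Σ_δ` norm. -/

section Estimates

variable {n : ℕ}

/-- `∬ |g(ξ) - g(η)|² |ξ - η|^{-n-2δ} dξ dη`. -/
noncomputable def gagliardoSq (δ : ℝ) (g : EuclideanSpace ℝ (Fin n) → ℂ) : ENNReal :=
  ∫⁻ p : EuclideanSpace ℝ (Fin n) × EuclideanSpace ℝ (Fin n),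
    ‖g p.1 - g p.2‖ₑ ^ 2 * ENNReal.ofReal (gagliardoKernel δ (p.1 - p.2))

/-- `∫ |x|^{2δ} |g(x)|² dx`. -/
noncomputable def weightedSq (δ : ℝ) (g : EuclideanSpace ℝ (Fin n) → ℂ) : ENNReal :=
  ∫⁻ x, ENNReal.ofReal (‖x‖ ^ (2 * δ)) * ‖g x‖ₑ ^ 2

/-- The truncated kernel `min(1, (1 + |ξ|)² |ξ - η|²) |ξ - η|^{-n-2δ}`. -/
noncomputable def truncatedKernel (δ : ℝ)
    (p : EuclideanSpace ℝ (Fin n) × EuclideanSpace ℝ (Fin n)) : ℝ :=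
  min 1 (((1 + ‖p.1‖) * ‖p.1 - p.2‖) ^ 2) * gagliardoKernel δ (p.1 - p.2)

@[fun_prop]
theorem measurable_truncatedKernel (δ : ℝ) :
    Measurable (truncatedKernel δ :
      EuclideanSpace ℝ (Fin n) × EuclideanSpace ℝ (Fin n) → ℝ) := by
  unfold truncatedKernel; fun_prop

/-- In polar coordinates the radial integrand is `y^{1-2δ}` near `0`, integrable since `δ < 1`, and
`y^{-1-2δ}` near infinity, integrable since `δ > 0`. -/
theorem integrable_min_mul_gagliardoKernel {δ : ℝ} (hδ0 : 0 < δ) (hδ1 : δ < 1) (hn : 1 ≤ n) :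
    Integrable fun z : EuclideanSpace ℝ (Fin n) => min 1 (‖z‖ ^ 2) * gagliardoKernel δ z := by
  have : Nonempty (Fin n) := ⟨⟨0, hn⟩⟩
  have hp : ∀ y : ℝ, 0 < y → y ^ (n - 1) * (y ^ ((n : ℝ) + 2 * δ))⁻¹ = y ^ (-1 - 2 * δ) := by
    intro y hy
    rw [← Real.rpow_natCast, ← Real.rpow_neg hy.le, ← Real.rpow_add hy]
    congr 1
    push_cast [Nat.cast_sub hn]
    ring
  refine (integrable_fun_norm_addHaar (volume : Measure (EuclideanSpace ℝ (Fin n)))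
    (f := fun y : ℝ => min 1 (y ^ 2) * (y ^ ((n : ℝ) + 2 * δ))⁻¹)).2 ?_
  rw [finrank_euclideanSpace_fin, ← Set.Ioc_union_Ioi_eq_Ioi (zero_le_one' ℝ)]
  refine IntegrableOn.union ?_ ?_
  · have h : IntegrableOn (fun y : ℝ => y ^ (1 - 2 * δ)) (Set.Ioc 0 1) := by
      have := intervalIntegral.intervalIntegrable_rpow' (a := 0) (b := 1) (r := 1 - 2 * δ)
        (by linarith)
      exact (intervalIntegrable_iff_integrableOn_Ioc_of_le zero_le_one).1 this
    refine h.congr_fun (fun y hy => ?_) measurableSet_Ioc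
    have h0 : 0 < y := hy.1
    have h1 : min 1 (y ^ 2) = y ^ 2 := min_eq_right (pow_le_one₀ h0.le hy.2)
    simp only [h1, smul_eq_mul]
    rw [mul_left_comm, hp y h0, ← Real.rpow_natCast, ← Real.rpow_add h0]
    congr 1
    push_cast
    ring
  · refine (integrableOn_Ioi_rpow_of_lt (a := -1 - 2 * δ) (by linarith) one_pos).congr_fun
      (fun y hy => ?_) measurableSet_Ioi
    have hy : 1 < y := hy
    have h1 : min 1 (y ^ 2) = 1 := min_eq_left (one_le_pow₀ hy.le)
    simp only [h1, smul_eq_mul, one_mul]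
    rw [hp y (by linarith)]

/-- Dilation by `1 + |ξ|` reduces to the profile `min(1, |z|²)|z|^{-n-2δ}`; the kernel contributes
the power `n + 2δ` and the Jacobian removes `n` of it. -/
theorem exists_lintegral_truncatedKernel_eq {δ : ℝ} (hδ0 : 0 < δ) (hδ1 : δ < 1) (hn : 1 ≤ n) :
    ∃ K : ℝ, 0 ≤ K ∧ ∀ ξ : EuclideanSpace ℝ (Fin n),
      ∫⁻ η, ENNReal.ofReal (truncatedKernel δ (ξ, η)) =
        ENNReal.ofReal (K * (1 + ‖ξ‖) ^ (2 * δ)) := by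
  have hI := integrable_min_mul_gagliardoKernel (n := n) hδ0 hδ1 hn
  set F : EuclideanSpace ℝ (Fin n) → ℝ := fun z => min 1 (‖z‖ ^ 2) * gagliardoKernel δ z with hF
  have hF0 : ∀ z, 0 ≤ F z := fun z => mul_nonneg (by positivity) (gagliardoKernel_nonneg _ _)
  refine ⟨∫ z, F z, integral_nonneg hF0, fun ξ => ?_⟩
  set r : ℝ := 1 + ‖ξ‖ with hr
  have hr0 : 0 < r := by positivity
  have h1 : ∀ z : EuclideanSpace ℝ (Fin n),
      min 1 ((r * ‖z‖) ^ 2) * gagliardoKernel δ z = r ^ ((n : ℝ) + 2 * δ) * F (r • z) := by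
    intro z
    simp only [hF, gagliardoKernel, norm_smul, Real.norm_of_nonneg hr0.le]
    rw [Real.mul_rpow hr0.le (norm_nonneg _)]
    have : r ^ ((n : ℝ) + 2 * δ) ≠ 0 := by positivity
    field_simp
  have h2 : ∫⁻ η, ENNReal.ofReal (truncatedKernel δ (ξ, η)) =
      ∫⁻ z : EuclideanSpace ℝ (Fin n),
        ENNReal.ofReal (r ^ ((n : ℝ) + 2 * δ) * F (r • z)) := by
    simp only [← h1]
    rw [← lintegral_sub_left_eq_self _ ξ]
    simp [truncatedKernel, hr]
  rw [h2, ← ofReal_integral_eq_lintegral_ofReal ((hI.comp_smul hr0.ne').const_mul _)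
    (Filter.Eventually.of_forall fun z => mul_nonneg (by positivity) (hF0 _)),
    integral_const_mul, Measure.integral_comp_smul, finrank_euclideanSpace_fin,
    abs_of_pos (by positivity), Real.rpow_add hr0, Real.rpow_natCast, smul_eq_mul]
  congr 1
  field_simp

theorem enorm_add_sq_le {F : Type*} [SeminormedAddCommGroup F] (x y : F) :
    ‖x + y‖ₑ ^ 2 ≤ 2 * ‖x‖ₑ ^ 2 + 2 * ‖y‖ₑ ^ 2 := by
  have h : ‖x + y‖ ^ 2 ≤ 2 * ‖x‖ ^ 2 + 2 * ‖y‖ ^ 2 := by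
    have := norm_add_le x y
    nlinarith [sq_nonneg (‖x‖ - ‖y‖), norm_nonneg (x + y), norm_nonneg x, norm_nonneg y]
  have := ENNReal.ofReal_le_ofReal h
  rw [ENNReal.ofReal_add (by positivity) (by positivity), ENNReal.ofReal_mul (by norm_num),
    ENNReal.ofReal_mul (by norm_num), ENNReal.ofReal_pow (norm_nonneg _),
    ENNReal.ofReal_pow (norm_nonneg _), ENNReal.ofReal_pow (norm_nonneg _), ofReal_norm,
    ofReal_norm, ofReal_norm] at this
  simpa using this

/-- The `Σ_δ` norm contains no `L²` term, so one has to be recovered. Off the unit ball the weight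
is at least `1`; on the ball, `g(ξ)` is compared with values `g(η)` on a distant ball, the
difference being paid for by the Gagliardo term. -/
theorem exists_lintegral_sq_le {δ : ℝ} (hδ0 : 0 < δ) (hn : 1 ≤ n) :
    ∃ C : ENNReal, C ≠ ⊤ ∧ ∀ g : EuclideanSpace ℝ (Fin n) → ℂ, Measurable g →
      ∫⁻ ξ, ‖g ξ‖ₑ ^ 2 ≤ C * (gagliardoSq δ g + weightedSq δ g) := by
  -- Norm `3` puts the points of the second ball at norm between `2` and `4`: the weight there is at
  -- least `1`, and their distance to the unit ball is positive and at most `5`, which bounds the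
  -- kernel below.
  obtain ⟨v, hv⟩ : ∃ v : EuclideanSpace ℝ (Fin n), ‖v‖ = 3 :=
    ⟨EuclideanSpace.single ⟨0, hn⟩ 3, by simp⟩
  set B : Set (EuclideanSpace ℝ (Fin n)) := Metric.ball 0 1 with hB
  set A : Set (EuclideanSpace ℝ (Fin n)) := Metric.ball v 1 with hA
  have hAB : volume A = volume B := by rw [hA, hB, Measure.addHaar_ball_center]
  have hB0 : volume B ≠ 0 := (Metric.measure_ball_pos _ _ one_pos).ne'
  have hBt : volume B ≠ ⊤ := measure_ball_lt_top.ne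
  set L : ENNReal := ENNReal.ofReal (5 ^ ((n : ℝ) + 2 * δ)) with hL
  refine ⟨(volume B)⁻¹ * (2 * L + 2 * volume B) + 1, by finiteness, fun g hg => ?_⟩
  have hA2 : ∀ η ∈ A, 2 ≤ ‖η‖ ∧ ‖η‖ ≤ 4 := by
    intro η hη
    rw [hA, mem_ball_iff_norm] at hη
    have h1 := abs_norm_sub_norm_le η v
    rw [abs_le, hv] at h1
    constructor <;> linarith [h1.1, h1.2]
  have hkey : ∀ ξ ∈ B, ∀ η ∈ A, ‖g ξ‖ₑ ^ 2 ≤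
      2 * L * (‖g ξ - g η‖ₑ ^ 2 * ENNReal.ofReal (gagliardoKernel δ (ξ - η))) +
      2 * (ENNReal.ofReal (‖η‖ ^ (2 * δ)) * ‖g η‖ₑ ^ 2) := by
    intro ξ hξ η hη
    rw [hB, mem_ball_zero_iff] at hξ
    obtain ⟨h2, h4⟩ := hA2 η hη
    have h := enorm_add_sq_le (g ξ - g η) (g η)
    rw [sub_add_cancel] at h
    refine h.trans (add_le_add ?_ ?_)
    · have h5 : ‖ξ - η‖ ≤ 5 := by linarith [norm_sub_le ξ η]
      have h0 : 0 < ‖ξ - η‖ := by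
        have := norm_sub_norm_le η ξ
        rw [norm_sub_rev] at this
        linarith
      have hk : 1 ≤ L * ENNReal.ofReal (gagliardoKernel δ (ξ - η)) := by
        rw [hL, ← ENNReal.ofReal_mul (by positivity), ← ENNReal.ofReal_one]
        refine ENNReal.ofReal_le_ofReal ?_
        rw [gagliardoKernel, ← div_eq_mul_inv, one_le_div (by positivity)]
        exact Real.rpow_le_rpow h0.le h5 (by positivity)
      calc 2 * ‖g ξ - g η‖ₑ ^ 2 = 2 * ‖g ξ - g η‖ₑ ^ 2 * 1 := (mul_one _).symm
        _ ≤ 2 * ‖g ξ - g η‖ₑ ^ 2 * (L * ENNReal.ofReal (gagliardoKernel δ (ξ - η))) := by gcongr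
        _ = _ := by ring
    · gcongr
      have h1 : 1 ≤ ENNReal.ofReal (‖η‖ ^ (2 * δ)) := by
        rw [ENNReal.one_le_ofReal]
        exact Real.one_le_rpow (by linarith) (by positivity)
      exact le_mul_of_one_le_left (by positivity) h1
  have hint : volume B * ∫⁻ ξ in B, ‖g ξ‖ₑ ^ 2 ≤
      2 * L * gagliardoSq δ g + 2 * volume B * weightedSq δ g := by
    calc volume B * ∫⁻ ξ in B, ‖g ξ‖ₑ ^ 2
        = ∫⁻ ξ in B, ∫⁻ _ in A, ‖g ξ‖ₑ ^ 2 := by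
          simp only [lintegral_const, Measure.restrict_apply_univ]
          rw [lintegral_mul_const _ (by fun_prop), hAB, mul_comm]
      _ ≤ ∫⁻ ξ in B, ∫⁻ η in A,
          (2 * L * (‖g ξ - g η‖ₑ ^ 2 * ENNReal.ofReal (gagliardoKernel δ (ξ - η))) +
          2 * (ENNReal.ofReal (‖η‖ ^ (2 * δ)) * ‖g η‖ₑ ^ 2)) :=
        setLIntegral_mono' measurableSet_ball fun ξ hξ =>
          setLIntegral_mono' measurableSet_ball fun η hη => hkey ξ hξ η hη
      _ = (∫⁻ ξ in B, ∫⁻ η in A,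
          2 * L * (‖g ξ - g η‖ₑ ^ 2 * ENNReal.ofReal (gagliardoKernel δ (ξ - η)))) +
          ∫⁻ _ in B, ∫⁻ η in A, 2 * (ENNReal.ofReal (‖η‖ ^ (2 * δ)) * ‖g η‖ₑ ^ 2) := by
        rw [← lintegral_add_right _ (by fun_prop)]
        refine lintegral_congr fun ξ => lintegral_add_right _ (by fun_prop)
      _ ≤ _ := by
        refine add_le_add ?_ ?_
        · calc _ ≤ ∫⁻ ξ, ∫⁻ η, 2 * L * (‖g ξ - g η‖ₑ ^ 2 *
                ENNReal.ofReal (gagliardoKernel δ (ξ - η))) :=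
                (setLIntegral_le_lintegral _ _).trans
                  (lintegral_mono fun ξ => setLIntegral_le_lintegral _ _)
            _ = _ := by
              rw [gagliardoSq, Measure.volume_eq_prod, lintegral_prod _ (by fun_prop),
                ← lintegral_const_mul _ (by fun_prop)]
              exact lintegral_congr fun ξ => lintegral_const_mul _ (by fun_prop)
        · rw [lintegral_const, Measure.restrict_apply_univ, lintegral_const_mul _ (by fun_prop),
            mul_right_comm]
          gcongr
          exact setLIntegral_le_lintegral _ _
  have hB1 : ∫⁻ ξ in B, ‖g ξ‖ₑ ^ 2 ≤
      (volume B)⁻¹ * (2 * L + 2 * volume B) * (gagliardoSq δ g + weightedSq δ g) := by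
    calc ∫⁻ ξ in B, ‖g ξ‖ₑ ^ 2
        = (volume B)⁻¹ * (volume B * ∫⁻ ξ in B, ‖g ξ‖ₑ ^ 2) := by
          rw [← mul_assoc, ENNReal.inv_mul_cancel hB0 hBt, one_mul]
      _ ≤ (volume B)⁻¹ * (2 * L * gagliardoSq δ g + 2 * volume B * weightedSq δ g) := by gcongr
      _ ≤ (volume B)⁻¹ * ((2 * L + 2 * volume B) * (gagliardoSq δ g + weightedSq δ g)) := by
        gcongr
        rw [mul_add]
        gcongr
        · exact le_self_add
        · exact le_add_self
      _ = _ := by ring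
  have hB2 : ∫⁻ ξ in Bᶜ, ‖g ξ‖ₑ ^ 2 ≤ 1 * (gagliardoSq δ g + weightedSq δ g) := by
    rw [one_mul]
    refine le_trans ?_ le_add_self
    calc ∫⁻ ξ in Bᶜ, ‖g ξ‖ₑ ^ 2
        ≤ ∫⁻ ξ in Bᶜ, ENNReal.ofReal (‖ξ‖ ^ (2 * δ)) * ‖g ξ‖ₑ ^ 2 := by
          refine setLIntegral_mono' measurableSet_ball.compl fun ξ hξ => ?_
          have h1 : 1 ≤ ‖ξ‖ := by simpa [hB] using hξ
          have h1 : 1 ≤ ENNReal.ofReal (‖ξ‖ ^ (2 * δ)) := by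
            rw [ENNReal.one_le_ofReal]
            exact Real.one_le_rpow h1 (by positivity)
          exact le_mul_of_one_le_left (by positivity) h1
      _ ≤ _ := setLIntegral_le_lintegral _ _
  rw [← lintegral_add_compl _ (measurableSet_ball : MeasurableSet B), add_mul]
  exact add_le_add hB1 hB2

theorem one_add_rpow_le {x p : ℝ} (hx : 0 ≤ x) (hp : 0 ≤ p) (hp2 : p ≤ 2) :
    (1 + x) ^ p ≤ 4 * (1 + x ^ p) := by
  have h4 : (2 : ℝ) ^ p ≤ 4 := by
    calc (2 : ℝ) ^ p ≤ 2 ^ (2 : ℝ) := Real.rpow_le_rpow_of_exponent_le (by norm_num) hp2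
      _ = 4 := by norm_num
  have hxp : 0 ≤ x ^ p := by positivity
  rcases le_total x 1 with h | h
  · calc (1 + x) ^ p ≤ 2 ^ p := Real.rpow_le_rpow (by linarith) (by linarith) hp
      _ ≤ 4 * (1 + x ^ p) := by linarith
  · calc (1 + x) ^ p ≤ (2 * x) ^ p := Real.rpow_le_rpow (by linarith) (by linarith) hp
      _ = 2 ^ p * x ^ p := Real.mul_rpow (by norm_num) hx
      _ ≤ 4 * x ^ p := by gcongr
      _ ≤ 4 * (1 + x ^ p) := by linarith

theorem exists_lintegral_truncatedKernel_le {δ : ℝ} (hδ0 : 0 < δ) (hδ1 : δ < 1) (hn : 1 ≤ n) :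
    ∃ C : ENNReal, C ≠ ⊤ ∧ ∀ g : EuclideanSpace ℝ (Fin n) → ℂ, Measurable g →
      ∫⁻ p : EuclideanSpace ℝ (Fin n) × EuclideanSpace ℝ (Fin n),
        ‖g p.1‖ₑ ^ 2 * ENNReal.ofReal (truncatedKernel δ p) ≤
      C * (gagliardoSq δ g + weightedSq δ g) := by
  obtain ⟨K, hK0, hK⟩ := exists_lintegral_truncatedKernel_eq (n := n) hδ0 hδ1 hn
  obtain ⟨C, hC, hCg⟩ := exists_lintegral_sq_le (n := n) hδ0 hn
  refine ⟨ENNReal.ofReal (4 * K) * (C + 1), by finiteness, fun g hg => ?_⟩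
  rw [Measure.volume_eq_prod, lintegral_prod _ (by fun_prop)]
  calc ∫⁻ ξ, ∫⁻ η, ‖g ξ‖ₑ ^ 2 * ENNReal.ofReal (truncatedKernel δ (ξ, η))
      = ∫⁻ ξ, ‖g ξ‖ₑ ^ 2 * ENNReal.ofReal (K * (1 + ‖ξ‖) ^ (2 * δ)) := by
        refine lintegral_congr fun ξ => ?_
        rw [lintegral_const_mul _ (by fun_prop), hK]
    _ ≤ ∫⁻ ξ, ENNReal.ofReal (4 * K) *
        (‖g ξ‖ₑ ^ 2 + ENNReal.ofReal (‖ξ‖ ^ (2 * δ)) * ‖g ξ‖ₑ ^ 2) := by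
        refine lintegral_mono fun ξ => ?_
        have h := one_add_rpow_le (norm_nonneg ξ) (p := 2 * δ) (by linarith) (by linarith)
        have h2 : K * (1 + ‖ξ‖) ^ (2 * δ) ≤ 4 * K * (1 + ‖ξ‖ ^ (2 * δ)) := by
          nlinarith
        calc ‖g ξ‖ₑ ^ 2 * ENNReal.ofReal (K * (1 + ‖ξ‖) ^ (2 * δ))
            ≤ ‖g ξ‖ₑ ^ 2 * ENNReal.ofReal (4 * K * (1 + ‖ξ‖ ^ (2 * δ))) := by gcongr
          _ = _ := by
            rw [ENNReal.ofReal_mul (by positivity), ENNReal.ofReal_add (by norm_num)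
              (by positivity), ENNReal.ofReal_one]
            ring
    _ = ENNReal.ofReal (4 * K) * ((∫⁻ ξ, ‖g ξ‖ₑ ^ 2) + weightedSq δ g) := by
        rw [lintegral_const_mul _ (by fun_prop), lintegral_add_left (by fun_prop), weightedSq]
    _ ≤ ENNReal.ofReal (4 * K) * (C * (gagliardoSq δ g + weightedSq δ g) +
        (gagliardoSq δ g + weightedSq δ g)) := by
        gcongr
        · exact hCg g hg
        · exact le_add_self
    _ = _ := by ring

/-- This is what singles out `s = (1 + |ξ|)|ξ - η|`: small `s` makes the gap at most `3s`, and a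
large gap keeps `s` away from `0`. -/
theorem abs_norm_sq_sub_norm_sq_le (ξ η : EuclideanSpace ℝ (Fin n)) :
    |‖η‖ ^ 2 - ‖ξ‖ ^ 2| ≤ 2 * ((1 + ‖ξ‖) * ‖ξ - η‖) + ((1 + ‖ξ‖) * ‖ξ - η‖) ^ 2 := by
  have h1 : |‖η‖ - ‖ξ‖| ≤ ‖ξ - η‖ := by
    rw [norm_sub_rev]; exact abs_norm_sub_norm_le η ξ
  have h2 : ‖η‖ + ‖ξ‖ ≤ 2 * ‖ξ‖ + ‖ξ - η‖ := by linarith [(abs_le.1 h1).2]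
  have h3 : |‖η‖ ^ 2 - ‖ξ‖ ^ 2| = |‖η‖ - ‖ξ‖| * (‖η‖ + ‖ξ‖) := by
    rw [show ‖η‖ ^ 2 - ‖ξ‖ ^ 2 = (‖η‖ - ‖ξ‖) * (‖η‖ + ‖ξ‖) by ring, abs_mul,
      abs_of_nonneg (by positivity : 0 ≤ ‖η‖ + ‖ξ‖)]
  have h4 : |‖η‖ - ‖ξ‖| * (‖η‖ + ‖ξ‖) ≤ ‖ξ - η‖ * (2 * ‖ξ‖ + ‖ξ - η‖) := by gcongr
  have h5 := norm_nonneg ξ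
  have h6 := norm_nonneg (ξ - η)
  have h7 : ‖ξ - η‖ ≤ (1 + ‖ξ‖) * ‖ξ - η‖ := by nlinarith
  have h8 : ‖ξ - η‖ ^ 2 ≤ ((1 + ‖ξ‖) * ‖ξ - η‖) ^ 2 := by gcongr
  rw [h3]
  nlinarith

end Estimates

/-! ### Growth of `h_δ[f]` in time and temperedness. -/

section Evolution

/-- The space `L²(ℝⁿ)`. -/
noncomputable abbrev L2E (n : ℕ) := Lp ℂ 2 (volume : Measure (EuclideanSpace ℝ (Fin n)))

variable {n : ℕ}

theorem gagliardoSq_congr_ae {δ : ℝ} {g₁ g₂ : EuclideanSpace ℝ (Fin n) → ℂ}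
    (h : g₁ =ᵐ[volume] g₂) : gagliardoSq δ g₁ = gagliardoSq δ g₂ := by
  refine lintegral_congr_ae ?_
  rw [Measure.volume_eq_prod]
  filter_upwards [Measure.quasiMeasurePreserving_fst.ae h,
    Measure.quasiMeasurePreserving_snd.ae h] with p h1 h2
  rw [h1, h2]

theorem weightedSq_fourierInv {δ : ℝ} (hδ0 : 0 < δ) (hδ1 : δ < 1) (hn : 1 ≤ n)
    (g : L2E n) :
    weightedSq δ (𝓕⁻ g : L2E n) = ENNReal.ofReal (bConst n δ) * gagliardoSq δ g := by
  have hb := bConst_pos (n := n) hδ0 hδ1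
  rw [gagliardoSq, lintegral_gagliardo hδ0 hδ1 hn, ← mul_assoc, ← ENNReal.ofReal_mul hb.le,
    mul_inv_cancel₀ hb.ne', ENNReal.ofReal_one, one_mul, weightedSq]

theorem weightedSq_schrodingerSolution {δ : ℝ} (hδ0 : 0 < δ) (hδ1 : δ < 1) (hn : 1 ≤ n)
    (f : L2E n) (t : ℝ) :
    weightedSq δ (schrodingerSolution f t) =
      ENNReal.ofReal (bConst n δ) * gagliardoSq δ fun ξ => schrodingerSymbol t ξ * (𝓕 f) ξ := by
  rw [schrodingerSolution, weightedSq_fourierInv hδ0 hδ1 hn]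
  congr 1
  exact gagliardoSq_congr_ae (MemLp.coeFn_toLp _)

theorem ofReal_weight_mul_sq (δ : ℝ) (g : EuclideanSpace ℝ (Fin n) → ℂ)
    (x : EuclideanSpace ℝ (Fin n)) :
    ENNReal.ofReal (‖x‖ ^ (2 * δ) * ‖g x‖ ^ 2) = ENNReal.ofReal (‖x‖ ^ (2 * δ)) * ‖g x‖ₑ ^ 2 := by
  rw [ENNReal.ofReal_mul (by positivity), ENNReal.ofReal_pow (norm_nonneg _), ofReal_norm]

theorem integrable_weight_iff (δ : ℝ) {g : EuclideanSpace ℝ (Fin n) → ℂ} (hg : Measurable g) :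
    Integrable (fun x => ‖x‖ ^ (2 * δ) * ‖g x‖ ^ 2) ↔ weightedSq δ g ≠ ⊤ := by
  rw [← lt_top_iff_ne_top, weightedSq]
  simp only [← ofReal_weight_mul_sq]
  have hm : AEStronglyMeasurable (fun x : EuclideanSpace ℝ (Fin n) =>
      ‖x‖ ^ (2 * δ) * ‖g x‖ ^ 2) volume :=
    Measurable.aestronglyMeasurable (by fun_prop)
  rw [← hasFiniteIntegral_iff_ofReal (Filter.Eventually.of_forall fun x => by positivity)]
  exact ⟨fun h => h.2, fun h => ⟨hm, h⟩⟩

theorem integral_weight_eq (δ : ℝ) {g : EuclideanSpace ℝ (Fin n) → ℂ} (hg : Measurable g) :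
    ∫ x, ‖x‖ ^ (2 * δ) * ‖g x‖ ^ 2 = (weightedSq δ g).toReal := by
  rw [integral_eq_lintegral_of_nonneg_ae (Filter.Eventually.of_forall fun x => by positivity)
    (Measurable.aestronglyMeasurable (by fun_prop)), weightedSq]
  simp only [ofReal_weight_mul_sq]

/-- The square of the `Σ_δ` norm, with values in `[0, ∞]`. -/
noncomputable def sigmaSq (δ : ℝ)
    (f : L2E n) : ENNReal :=
  weightedSq δ f + weightedSq δ (𝓕 f : L2E n)

theorem MemSigma.sigmaSq_ne_top {δ : ℝ} {f : L2E n}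
    (hf : MemSigma δ f) : sigmaSq δ f ≠ ⊤ :=
  ENNReal.add_ne_top.2 ⟨(integrable_weight_iff δ (measurable_coeFn_Lp f)).1 hf.1,
    (integrable_weight_iff δ (measurable_coeFn_Lp (𝓕 f))).1 hf.2⟩

theorem MemSigma.toReal_sigmaSq {δ : ℝ} {f : L2E n}
    (hf : MemSigma δ f) : (sigmaSq δ f).toReal = sigmaNormSq δ f := by
  rw [sigmaSq, ENNReal.toReal_add ((integrable_weight_iff δ (measurable_coeFn_Lp f)).1 hf.1)
    ((integrable_weight_iff δ (measurable_coeFn_Lp (𝓕 f))).1 hf.2), sigmaNormSq,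
    integral_weight_eq δ (measurable_coeFn_Lp f), integral_weight_eq δ (measurable_coeFn_Lp (𝓕 f))]

/-- The Gagliardo term of `f̂` is exactly `b⁻¹` times the spatial moment of `f`, so all later
estimates can be made on the Fourier side. -/
theorem exists_gagliardoSq_add_weightedSq_le {δ : ℝ} (hδ0 : 0 < δ) (hδ1 : δ < 1) (hn : 1 ≤ n) :
    ∃ C : ENNReal, C ≠ ⊤ ∧ ∀ f : L2E n,
      gagliardoSq δ (𝓕 f : L2E n) + weightedSq δ (𝓕 f : L2E n) ≤ C * sigmaSq δ f := by
  refine ⟨ENNReal.ofReal (bConst n δ)⁻¹ + 1, by finiteness, fun f => ?_⟩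
  have h : gagliardoSq δ (𝓕 f : L2E n) = ENNReal.ofReal (bConst n δ)⁻¹ * weightedSq δ f := by
    have := lintegral_gagliardo hδ0 hδ1 hn (𝓕 f)
    rw [FourierPair.fourierInv_fourier_eq] at this
    exact this
  rw [h, sigmaSq, add_mul, one_mul]
  exact add_le_add (by gcongr; exact le_self_add) le_add_self

theorem norm_schrodingerSymbol (t : ℝ) (ξ : EuclideanSpace ℝ (Fin n)) :
    ‖schrodingerSymbol t ξ‖ = 1 := by
  rw [schrodingerSymbol, Complex.norm_exp_ofReal_mul_I]

theorem continuous_uncurry_schrodingerSymbol :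
    Continuous fun q : ℝ × EuclideanSpace ℝ (Fin n) => schrodingerSymbol q.1 q.2 := by
  unfold schrodingerSymbol
  fun_prop

@[fun_prop]
theorem Measurable.schrodingerSymbol {α : Type*} [MeasurableSpace α] {t : α → ℝ}
    {ξ : α → EuclideanSpace ℝ (Fin n)} (ht : Measurable t) (hξ : Measurable ξ) :
    Measurable fun x => schrodingerSymbol (t x) (ξ x) :=
  continuous_uncurry_schrodingerSymbol.measurable.comp (ht.prodMk hξ)

/-- For `s ≤ 1` the phase is Lipschitz in the gap; for `s ≥ 1` the trivial bound `2` suffices. The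
constant `12` is `4 · 3`, from `π ≤ 4` and a gap of at most `3s`. -/
theorem norm_schrodingerSymbol_sub_sq_le (t : ℝ) (ξ η : EuclideanSpace ℝ (Fin n)) :
    ‖schrodingerSymbol t ξ - schrodingerSymbol t η‖ ^ 2 ≤
      (12 * (1 + |t|)) ^ 2 * min 1 (((1 + ‖ξ‖) * ‖ξ - η‖) ^ 2) := by
  set s := (1 + ‖ξ‖) * ‖ξ - η‖ with hs
  have hs0 : 0 ≤ s := by positivity
  have ht := abs_nonneg t
  have h2 : ‖schrodingerSymbol t ξ - schrodingerSymbol t η‖ ≤ 2 := by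
    have := norm_sub_le (schrodingerSymbol t ξ) (schrodingerSymbol t η)
    rw [norm_schrodingerSymbol, norm_schrodingerSymbol] at this
    linarith
  have h1 : ‖schrodingerSymbol t ξ - schrodingerSymbol t η‖ ≤
      Real.pi * |t| * |‖η‖ ^ 2 - ‖ξ‖ ^ 2| := by
    have e : schrodingerSymbol t ξ - schrodingerSymbol t η =
        schrodingerSymbol t η *
          (Complex.exp (Complex.I * ((Real.pi * t * (‖η‖ ^ 2 - ‖ξ‖ ^ 2) : ℝ) : ℂ)) - 1) := by
      rw [mul_sub, mul_one, schrodingerSymbol, schrodingerSymbol, ← Complex.exp_add]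
      congr 2
      push_cast
      ring
    rw [e, norm_mul, norm_schrodingerSymbol, one_mul]
    refine Real.norm_exp_I_mul_ofReal_sub_one_le.trans ?_
    rw [Real.norm_eq_abs, abs_mul, abs_mul, abs_of_pos Real.pi_pos]
  have h3 := abs_norm_sq_sub_norm_sq_le ξ η
  rw [← hs] at h3
  rcases le_total s 1 with h | h
  · rw [min_eq_right (pow_le_one₀ hs0 h), ← mul_pow]
    gcongr
    refine h1.trans ?_
    have h4 : |‖η‖ ^ 2 - ‖ξ‖ ^ 2| ≤ 3 * s := h3.trans (by nlinarith)
    calc Real.pi * |t| * |‖η‖ ^ 2 - ‖ξ‖ ^ 2| ≤ 4 * (1 + |t|) * (3 * s) := by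
          gcongr
          · exact Real.pi_le_four
          · linarith
      _ = 12 * (1 + |t|) * s := by ring
  · rw [min_eq_left (one_le_pow₀ h), mul_one]
    gcongr
    linarith

theorem exists_weightedSq_schrodingerSolution_le {δ : ℝ} (hδ0 : 0 < δ) (hδ1 : δ < 1)
    (hn : 1 ≤ n) :
    ∃ C : ENNReal, C ≠ ⊤ ∧ ∀ (f : L2E n) (t : ℝ),
      weightedSq δ (schrodingerSolution f t) ≤
        C * ENNReal.ofReal ((1 + |t|) ^ 2) * sigmaSq δ f := by
  obtain ⟨C₁, hC₁, h₁⟩ := exists_gagliardoSq_add_weightedSq_le (n := n) hδ0 hδ1 hn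
  obtain ⟨C₂, hC₂, h₂⟩ := exists_lintegral_truncatedKernel_le (n := n) hδ0 hδ1 hn
  refine ⟨ENNReal.ofReal (bConst n δ) * ((2 + 2 * (ENNReal.ofReal (12 ^ 2) * C₂)) * C₁),
    by finiteness, fun f t => ?_⟩
  have hg := measurable_coeFn_Lp (𝓕 f)
  set g := (𝓕 f : L2E n) with hgdef
  set T := ENNReal.ofReal ((1 + |t|) ^ 2) with hT
  have hT1 : 1 ≤ T := by
    rw [hT, ENNReal.one_le_ofReal]
    exact one_le_pow₀ (by linarith [abs_nonneg t])
  have hpt : ∀ ξ η : EuclideanSpace ℝ (Fin n),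
      ‖schrodingerSymbol t ξ * g ξ - schrodingerSymbol t η * g η‖ₑ ^ 2 *
        ENNReal.ofReal (gagliardoKernel δ (ξ - η)) ≤
      2 * (‖g ξ - g η‖ₑ ^ 2 * ENNReal.ofReal (gagliardoKernel δ (ξ - η))) +
      2 * (ENNReal.ofReal (12 ^ 2) * T) *
        (‖g ξ‖ₑ ^ 2 * ENNReal.ofReal (truncatedKernel δ (ξ, η))) := by
    intro ξ η
    -- A discrete Leibniz rule: one term is the time-independent Gagliardo difference of `g`, the
    -- other puts the difference on the phase, where the truncated kernel takes over.
    have e : schrodingerSymbol t ξ * g ξ - schrodingerSymbol t η * g η =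
        schrodingerSymbol t η * (g ξ - g η) +
          (schrodingerSymbol t ξ - schrodingerSymbol t η) * g ξ := by ring
    have h1 : ‖schrodingerSymbol t η‖ₑ = 1 := by
      rw [← ofReal_norm, norm_schrodingerSymbol, ENNReal.ofReal_one]
    have h := enorm_add_sq_le (schrodingerSymbol t η * (g ξ - g η))
      ((schrodingerSymbol t ξ - schrodingerSymbol t η) * g ξ)
    rw [← e, enorm_mul, enorm_mul, h1, one_mul] at h
    have h3 : ‖schrodingerSymbol t ξ - schrodingerSymbol t η‖ₑ ^ 2 ≤
        ENNReal.ofReal (12 ^ 2) * T *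
          ENNReal.ofReal (min 1 (((1 + ‖ξ‖) * ‖ξ - η‖) ^ 2)) := by
      rw [hT, ← ENNReal.ofReal_mul (by positivity), ← ENNReal.ofReal_mul (by positivity),
        ← ofReal_norm, ← ENNReal.ofReal_pow (norm_nonneg _), ← mul_pow]
      exact ENNReal.ofReal_le_ofReal (norm_schrodingerSymbol_sub_sq_le t ξ η)
    calc _ ≤ (2 * ‖g ξ - g η‖ₑ ^ 2 +
          2 * (ENNReal.ofReal (12 ^ 2) * T *
            ENNReal.ofReal (min 1 (((1 + ‖ξ‖) * ‖ξ - η‖) ^ 2)) * ‖g ξ‖ₑ ^ 2)) *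
          ENNReal.ofReal (gagliardoKernel δ (ξ - η)) := by
          rw [mul_pow] at h
          gcongr
          exact h.trans (by gcongr)
      _ = _ := by
        rw [truncatedKernel, ENNReal.ofReal_mul (p := min 1 _) (by positivity)]
        ring
  rw [weightedSq_schrodingerSolution hδ0 hδ1 hn]
  have hG : (gagliardoSq δ fun ξ => schrodingerSymbol t ξ * g ξ) ≤
      2 * gagliardoSq δ g + 2 * (ENNReal.ofReal (12 ^ 2) * T) *
        ∫⁻ p : EuclideanSpace ℝ (Fin n) × EuclideanSpace ℝ (Fin n),
          ‖g p.1‖ₑ ^ 2 * ENNReal.ofReal (truncatedKernel δ p) := by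
    rw [gagliardoSq, gagliardoSq, ← lintegral_const_mul _ (by fun_prop),
      ← lintegral_const_mul _ (by fun_prop), ← lintegral_add_left (by fun_prop)]
    exact lintegral_mono fun p => hpt p.1 p.2
  have hS := h₁ f
  have hW := h₂ g hg
  rw [← hgdef] at hS
  set S := gagliardoSq δ g + weightedSq δ g with hSdef
  calc ENNReal.ofReal (bConst n δ) * gagliardoSq δ (fun ξ => schrodingerSymbol t ξ * g ξ)
      ≤ ENNReal.ofReal (bConst n δ) *
        (2 * (T * S) + 2 * (ENNReal.ofReal (12 ^ 2) * T) * (C₂ * S)) := by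
        gcongr
        refine hG.trans ?_
        gcongr
        calc gagliardoSq δ g ≤ 1 * S := by rw [one_mul]; exact le_self_add
          _ ≤ T * S := by gcongr
    _ = ENNReal.ofReal (bConst n δ) * ((2 + 2 * (ENNReal.ofReal (12 ^ 2) * C₂))) * T * S := by
        ring
    _ ≤ ENNReal.ofReal (bConst n δ) * ((2 + 2 * (ENNReal.ofReal (12 ^ 2) * C₂))) * T *
        (C₁ * sigmaSq δ f) := by gcongr
    _ = _ := by ring

theorem integrable_schrodingerSolution {δ : ℝ} (hδ0 : 0 < δ) (hδ1 : δ < 1) (hn : 1 ≤ n)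
    {f : L2E n} (hf : MemSigma δ f) (t : ℝ) :
    Integrable (fun x : EuclideanSpace ℝ (Fin n) =>
      ‖x‖ ^ (2 * δ) * ‖schrodingerSolution f t x‖ ^ 2) := by
  obtain ⟨C, hC, h⟩ := exists_weightedSq_schrodingerSolution_le (n := n) hδ0 hδ1 hn
  have := hf.sigmaSq_ne_top
  rw [integrable_weight_iff δ (measurable_coeFn_Lp _)]
  exact ne_top_of_le_ne_top (by finiteness) (h f t)

theorem hDelta_eq_toReal (δ : ℝ) (f : L2E n)
    (t : ℝ) : hDelta δ f t = (weightedSq δ (schrodingerSolution f t)).toReal :=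
  integral_weight_eq δ (measurable_coeFn_Lp _)

theorem hDelta_nonneg (δ : ℝ) (f : L2E n)
    (t : ℝ) : 0 ≤ hDelta δ f t := by
  rw [hDelta_eq_toReal]; exact ENNReal.toReal_nonneg

/-- The representatives of `u(·, t)` are chosen separately for each `t`, so joint measurability is
not visible in the definition. The Gagliardo formula has a jointly measurable integrand. -/
theorem measurable_hDelta {δ : ℝ} (hδ0 : 0 < δ) (hδ1 : δ < 1) (hn : 1 ≤ n)
    (f : L2E n) : Measurable (hDelta δ f) := by
  have hg := measurable_coeFn_Lp (𝓕 f)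
  set g := (𝓕 f : L2E n) with hgdef
  have : hDelta δ f = fun t => (ENNReal.ofReal (bConst n δ) *
      ∫⁻ p : EuclideanSpace ℝ (Fin n) × EuclideanSpace ℝ (Fin n),
        ‖schrodingerSymbol t p.1 * g p.1 - schrodingerSymbol t p.2 * g p.2‖ₑ ^ 2 *
          ENNReal.ofReal (gagliardoKernel δ (p.1 - p.2))).toReal := by
    ext t
    rw [hDelta_eq_toReal, weightedSq_schrodingerSolution hδ0 hδ1 hn, gagliardoSq]
  rw [this]
  have hq : Measurable fun q : ℝ × (EuclideanSpace ℝ (Fin n) × EuclideanSpace ℝ (Fin n)) =>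
      ‖schrodingerSymbol q.1 q.2.1 * g q.2.1 - schrodingerSymbol q.1 q.2.2 * g q.2.2‖ₑ ^ 2 *
        ENNReal.ofReal (gagliardoKernel δ (q.2.1 - q.2.2)) := by
    fun_prop
  exact (hq.lintegral_prod_right'.const_mul _).ennreal_toReal

theorem exists_hDelta_le {δ : ℝ} (hδ0 : 0 < δ) (hδ1 : δ < 1) (hn : 1 ≤ n)
    {f : L2E n} (hf : MemSigma δ f) :
    ∃ C : ℝ, ∀ t, hDelta δ f t ≤ C * (1 + |t|) ^ 2 := by
  obtain ⟨C, hC, h⟩ := exists_weightedSq_schrodingerSolution_le (n := n) hδ0 hδ1 hn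
  have hS := hf.sigmaSq_ne_top
  refine ⟨(C * sigmaSq δ f).toReal, fun t => ?_⟩
  rw [hDelta_eq_toReal]
  have := ENNReal.toReal_mono (by finiteness) (h f t)
  rw [ENNReal.toReal_mul, ENNReal.toReal_mul, ENNReal.toReal_ofReal (by positivity)] at this
  rw [ENNReal.toReal_mul]
  linarith

theorem exists_isDistributionOf {h : ℝ → ℝ} (hm : Measurable h) (h0 : ∀ t, 0 ≤ h t) {C : ℝ}
    (hC : ∀ t, h t ≤ C * (1 + |t|) ^ 2) : ∃ H : 𝓢'(ℝ, ℂ), IsDistributionOf h H := by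
  set μ : Measure ℝ := volume.withDensity fun t => ENNReal.ofReal (h t) with hμ
  have hmeas : Measurable fun t => ENNReal.ofReal (h t) := by fun_prop
  have hlt : ∀ᵐ t, ENNReal.ofReal (h t) < ⊤ := by simp
  have hμt : μ.HasTemperateGrowth := by
    -- Quadratic growth against the power `-4` leaves `(1 + |t|)^{-2}`, which is integrable on the
    -- line.
    refine ⟨4, ?_⟩
    rw [hμ, integrable_withDensity_iff hmeas hlt]
    have hb : Integrable fun t : ℝ => C * (1 + ‖t‖) ^ (-(2 : ℝ)) :=
      (integrable_one_add_norm (by simp)).const_mul _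
    refine hb.mono' (Measurable.aestronglyMeasurable (by fun_prop)) ?_
    filter_upwards with t
    have ht : 0 < 1 + ‖t‖ := by positivity
    rw [Real.norm_of_nonneg (by positivity), ENNReal.toReal_ofReal (h0 t)]
    calc (1 + ‖t‖) ^ (-((4 : ℕ) : ℝ)) * h t
        ≤ (1 + ‖t‖) ^ (-((4 : ℕ) : ℝ)) * (C * (1 + ‖t‖) ^ 2) := by
          gcongr
          exact hC t
      _ = C * ((1 + ‖t‖) ^ (-((4 : ℕ) : ℝ)) * (1 + ‖t‖) ^ (2 : ℝ)) := by
          rw [Real.rpow_ofNat]; ring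
      _ = _ := by
          rw [← Real.rpow_add ht]
          norm_num
  refine ⟨μ.toTemperedDistribution, fun φ => ⟨?_, ?_⟩⟩
  · have h1 : Integrable φ μ := φ.integrable
    rw [hμ, integrable_withDensity_iff_integrable_smul' hmeas hlt] at h1
    refine h1.congr (Filter.Eventually.of_forall fun t => ?_)
    simp only [ENNReal.toReal_ofReal (h0 t), Complex.real_smul]
  · rw [Measure.toTemperedDistribution_apply μ, hμ, integral_withDensity_eq_integral_toReal_smul
      hmeas hlt]
    refine integral_congr_ae (Filter.Eventually.of_forall fun t => ?_)
    simp only [ENNReal.toReal_ofReal (h0 t), Complex.real_smul]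

end Evolution

/-! ### The transform of `h_δ[f]` away from the origin. -/

section Representation

variable {n : ℕ}

/-- The density `g(ξ) conj(g(η)) |ξ - η|^{-n-2δ}`. -/
noncomputable def pairDensity (δ : ℝ) (g : EuclideanSpace ℝ (Fin n) → ℂ)
    (p : EuclideanSpace ℝ (Fin n) × EuclideanSpace ℝ (Fin n)) : ℂ :=
  g p.1 * (starRingEnd ℂ) (g p.2) * (gagliardoKernel δ (p.1 - p.2) : ℂ)

/-- The frequency `(|η|² - |ξ|²) / 2`. -/
noncomputable def energyGap (p : EuclideanSpace ℝ (Fin n) × EuclideanSpace ℝ (Fin n)) : ℝ :=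
  (‖p.2‖ ^ 2 - ‖p.1‖ ^ 2) / 2

@[fun_prop]
theorem measurable_energyGap :
    Measurable (energyGap : EuclideanSpace ℝ (Fin n) × EuclideanSpace ℝ (Fin n) → ℝ) := by
  unfold energyGap; fun_prop

theorem measurable_pairDensity (δ : ℝ) {g : EuclideanSpace ℝ (Fin n) → ℂ} (hg : Measurable g) :
    Measurable (pairDensity δ g) := by
  unfold pairDensity
  fun_prop

theorem hFourierIntegrand_eq (δ : ℝ) (f : L2E n) (φ : ℝ → ℂ)
    (p : EuclideanSpace ℝ (Fin n) × EuclideanSpace ℝ (Fin n)) :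
    hFourierIntegrand δ f φ p = pairDensity δ (𝓕 f : L2E n) p * φ (energyGap p) := by
  rw [hFourierIntegrand, pairDensity, energyGap, gagliardoKernel, Complex.ofReal_inv]
  ring

theorem enorm_pairDensity (δ : ℝ) (g : EuclideanSpace ℝ (Fin n) → ℂ)
    (p : EuclideanSpace ℝ (Fin n) × EuclideanSpace ℝ (Fin n)) :
    ‖pairDensity δ g p‖ₑ = ‖g p.1‖ₑ * ‖g p.2‖ₑ * ENNReal.ofReal (gagliardoKernel δ (p.1 - p.2)) := by
  have h1 : ‖(starRingEnd ℂ) (g p.2)‖ₑ = ‖g p.2‖ₑ := by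
    rw [← ofReal_norm, RCLike.norm_conj, ofReal_norm]
  have h2 : ‖(gagliardoKernel δ (p.1 - p.2) : ℂ)‖ₑ =
      ENNReal.ofReal (gagliardoKernel δ (p.1 - p.2)) := by
    rw [← ofReal_norm, Complex.norm_of_nonneg (gagliardoKernel_nonneg _ _)]
  rw [pairDensity, enorm_mul, enorm_mul, h1, h2]

/-- The hypothesis gives `2a ≤ 2s + s²`. Either `s ≥ 1`, or `2a ≤ 3s`; in both cases `s ≥ min(1,
2a/3)`, and the truncation costs only a constant. -/
theorem gagliardoKernel_le_of_le_energyGap {a δ : ℝ} (ha : 0 < a)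
    {p : EuclideanSpace ℝ (Fin n) × EuclideanSpace ℝ (Fin n)} (hp : a ≤ |energyGap p|) :
    gagliardoKernel δ (p.1 - p.2) ≤ ((min 1 (2 * a / 3)) ^ 2)⁻¹ * truncatedKernel δ p := by
  set c := min 1 (2 * a / 3) with hc
  have hc0 : 0 < c := lt_min one_pos (by positivity)
  set s := (1 + ‖p.1‖) * ‖p.1 - p.2‖ with hs
  have hs0 : 0 ≤ s := by positivity
  have h1 := abs_norm_sq_sub_norm_sq_le p.1 p.2
  rw [← hs] at h1
  rw [energyGap, abs_div, abs_two] at hp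
  have h2 : c ^ 2 ≤ min 1 (s ^ 2) := by
    rcases le_total 1 s with h | h
    · rw [min_eq_left (one_le_pow₀ h)]
      exact pow_le_one₀ hc0.le (min_le_left _ _)
    · rw [min_eq_right (pow_le_one₀ hs0 h)]
      have : 2 * a / 3 ≤ s := by nlinarith
      have : c ≤ s := (min_le_right _ _).trans this
      gcongr
  rw [truncatedKernel, ← hs, ← mul_assoc]
  refine le_mul_of_one_le_left (gagliardoKernel_nonneg _ _) ?_
  rw [inv_mul_eq_div, one_le_div (by positivity)]
  exact h2

theorem exists_lintegral_pairDensity_le {δ : ℝ} (hδ0 : 0 < δ) (hδ1 : δ < 1) (hn : 1 ≤ n) :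
    ∃ C : ℝ → ENNReal, (∀ a, C a ≠ ⊤) ∧ ∀ a, 0 < a → ∀ f : L2E n,
      ∫⁻ p in {p | a ≤ |energyGap p|}, ‖pairDensity δ (𝓕 f : L2E n) p‖ₑ ≤ C a * sigmaSq δ f := by
  obtain ⟨C₁, hC₁, h₁⟩ := exists_gagliardoSq_add_weightedSq_le (n := n) hδ0 hδ1 hn
  obtain ⟨C₂, hC₂, h₂⟩ := exists_lintegral_truncatedKernel_le (n := n) hδ0 hδ1 hn
  refine ⟨fun a => ENNReal.ofReal (((min 1 (2 * a / 3)) ^ 2)⁻¹) * (2 * C₂ * C₁),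
    fun a => by finiteness, fun a ha f => ?_⟩
  have hg := measurable_coeFn_Lp (𝓕 f)
  have hS := h₁ f
  set g := (𝓕 f : L2E n) with hgdef
  have hW := h₂ g hg
  set c := ENNReal.ofReal (((min 1 (2 * a / 3)) ^ 2)⁻¹) with hc
  set W := ∫⁻ p : EuclideanSpace ℝ (Fin n) × EuclideanSpace ℝ (Fin n),
        ‖g p.1‖ₑ ^ 2 * ENNReal.ofReal (truncatedKernel δ p) with hWdef
  have hswap : ∫⁻ p : EuclideanSpace ℝ (Fin n) × EuclideanSpace ℝ (Fin n),
        ‖g p.2‖ₑ ^ 2 * ENNReal.ofReal (truncatedKernel δ p.swap) = W := by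
    rw [hWdef, Measure.volume_eq_prod, ← lintegral_prod_swap]
    simp
  -- The truncated kernel is not symmetric in its two points, whereas the absolute gap is. The bound
  -- is therefore used at `p` or at `p.swap`, so that the weight `1 + |·|` sits on the point where
  -- `|g|` is larger.
  have hker : ∀ p : EuclideanSpace ℝ (Fin n) × EuclideanSpace ℝ (Fin n), a ≤ |energyGap p| →
      ENNReal.ofReal (gagliardoKernel δ (p.1 - p.2)) ≤
        c * ENNReal.ofReal (truncatedKernel δ p) := by
    intro p hp
    rw [hc, ← ENNReal.ofReal_mul (by positivity)]
    exact ENNReal.ofReal_le_ofReal (gagliardoKernel_le_of_le_energyGap ha hp)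
  calc ∫⁻ p in {p | a ≤ |energyGap p|}, ‖pairDensity δ g p‖ₑ
      ≤ ∫⁻ p in {p : EuclideanSpace ℝ (Fin n) × EuclideanSpace ℝ (Fin n) | a ≤ |energyGap p|},
          c * (‖g p.1‖ₑ ^ 2 * ENNReal.ofReal (truncatedKernel δ p) +
          ‖g p.2‖ₑ ^ 2 * ENNReal.ofReal (truncatedKernel δ p.swap)) := by
        refine setLIntegral_mono' (measurableSet_le measurable_const (by fun_prop)) fun p hp => ?_
        have k1 := hker p hp
        have k2 : ENNReal.ofReal (gagliardoKernel δ (p.1 - p.2)) ≤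
            c * ENNReal.ofReal (truncatedKernel δ p.swap) := by
          have := hker p.swap (by
            have e : energyGap p.swap = - energyGap p := by
              simp only [energyGap, Prod.fst_swap, Prod.snd_swap]; ring
            rw [e, abs_neg]; exact hp)
          rwa [Prod.fst_swap, Prod.snd_swap, ← gagliardoKernel_neg, neg_sub] at this
        rw [enorm_pairDensity]
        rcases le_total ‖g p.1‖ₑ ‖g p.2‖ₑ with h | h
        · calc _ ≤ ‖g p.2‖ₑ * ‖g p.2‖ₑ * (c * ENNReal.ofReal (truncatedKernel δ p.swap)) := by
                gcongr
            _ = c * (‖g p.2‖ₑ ^ 2 * ENNReal.ofReal (truncatedKernel δ p.swap)) := by ring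
            _ ≤ _ := by gcongr; exact le_add_self
        · calc _ ≤ ‖g p.1‖ₑ * ‖g p.1‖ₑ * (c * ENNReal.ofReal (truncatedKernel δ p)) := by
                gcongr
            _ = c * (‖g p.1‖ₑ ^ 2 * ENNReal.ofReal (truncatedKernel δ p)) := by ring
            _ ≤ _ := by gcongr; exact le_self_add
    _ ≤ ∫⁻ p : EuclideanSpace ℝ (Fin n) × EuclideanSpace ℝ (Fin n),
          c * (‖g p.1‖ₑ ^ 2 * ENNReal.ofReal (truncatedKernel δ p) +
          ‖g p.2‖ₑ ^ 2 * ENNReal.ofReal (truncatedKernel δ p.swap)) := setLIntegral_le_lintegral _ _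
    _ = c * (W + W) := by
        rw [lintegral_const_mul _ (by fun_prop), lintegral_add_left (by fun_prop), hswap]
    _ ≤ c * (C₂ * (C₁ * sigmaSq δ f) + C₂ * (C₁ * sigmaSq δ f)) := by
        have : W ≤ C₂ * (C₁ * sigmaSq δ f) := hW.trans (by gcongr)
        gcongr
    _ = _ := by ring

theorem integral_exp_mul_fourier (φ : 𝓢(ℝ, ℂ)) (τ : ℝ) :
    ∫ t : ℝ, Complex.exp (((2 * Real.pi * t * τ : ℝ) : ℂ) * Complex.I) * 𝓕 φ t = φ τ := by
  have h : 𝓕⁻ (𝓕 φ) τ = φ τ := by rw [FourierPair.fourierInv_fourier_eq]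
  rw [← h, fourierInv_coe, Real.fourierInv_eq']
  refine integral_congr_ae (Filter.Eventually.of_forall fun t => ?_)
  simp only [smul_eq_mul, RCLike.inner_apply, conj_trivial]
  congr 4
  ring

theorem integrable_exp_mul_fourier (φ : 𝓢(ℝ, ℂ)) (τ : ℝ) :
    Integrable fun t : ℝ => Complex.exp (((2 * Real.pi * t * τ : ℝ) : ℂ) * Complex.I) * 𝓕 φ t := by
  refine (𝓕 φ).integrable.bdd_mul (c := 1) (Continuous.aestronglyMeasurable (by fun_prop)) ?_
  filter_upwards with t
  rw [Complex.norm_exp_ofReal_mul_I]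

theorem schrodingerSymbol_mul_conj (t : ℝ)
    (p : EuclideanSpace ℝ (Fin n) × EuclideanSpace ℝ (Fin n)) :
    schrodingerSymbol t p.1 * (starRingEnd ℂ) (schrodingerSymbol t p.2) =
      Complex.exp (((2 * Real.pi * t * energyGap p : ℝ) : ℂ) * Complex.I) := by
  rw [schrodingerSymbol, schrodingerSymbol, ← Complex.exp_conj, ← Complex.exp_add]
  congr 1
  simp only [map_mul, Complex.conj_ofReal, Complex.conj_I, energyGap]
  push_cast
  ring

/-- `|û(ξ, t) - û(η, t)|² |ξ - η|^{-n-2δ}` for `û(·, t) = e^{-πit|·|²} g`. -/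
noncomputable def gagliardoEnergy (δ : ℝ) (g : EuclideanSpace ℝ (Fin n) → ℂ) (t : ℝ)
    (p : EuclideanSpace ℝ (Fin n) × EuclideanSpace ℝ (Fin n)) : ℝ :=
  ‖schrodingerSymbol t p.1 * g p.1 - schrodingerSymbol t p.2 * g p.2‖ ^ 2 *
    gagliardoKernel δ (p.1 - p.2)

theorem gagliardoEnergy_nonneg (δ : ℝ) (g : EuclideanSpace ℝ (Fin n) → ℂ) (t : ℝ)
    (p : EuclideanSpace ℝ (Fin n) × EuclideanSpace ℝ (Fin n)) : 0 ≤ gagliardoEnergy δ g t p :=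
  mul_nonneg (by positivity) (gagliardoKernel_nonneg _ _)

/-- At a fixed pair of frequencies the energy is a trigonometric polynomial in `t`, and Fourier
inversion evaluates `φ` at its frequencies. The diagonal part has frequency `0` and is killed by `φ
0 = 0`; this happens before any integration over `p`, where that part could diverge. -/
theorem integral_gagliardoEnergy_mul_fourier (δ : ℝ) (g : EuclideanSpace ℝ (Fin n) → ℂ)
    (φ : 𝓢(ℝ, ℂ)) (hφ : φ 0 = 0) (p : EuclideanSpace ℝ (Fin n) × EuclideanSpace ℝ (Fin n)) :
    ∫ t : ℝ, (gagliardoEnergy δ g t p : ℂ) * 𝓕 φ t =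
      -(pairDensity δ g p * φ (energyGap p) +
        pairDensity δ g p.swap * φ (energyGap p.swap)) := by
  have hE : ∀ t : ℝ, (gagliardoEnergy δ g t p : ℂ) * 𝓕 φ t =
      (((‖g p.1‖ ^ 2 + ‖g p.2‖ ^ 2) * gagliardoKernel δ (p.1 - p.2) : ℝ) : ℂ) *
        (Complex.exp (((2 * Real.pi * t * 0 : ℝ) : ℂ) * Complex.I) * 𝓕 φ t) -
      (pairDensity δ g p *
        (Complex.exp (((2 * Real.pi * t * energyGap p : ℝ) : ℂ) * Complex.I) * 𝓕 φ t) +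
      pairDensity δ g p.swap *
        (Complex.exp (((2 * Real.pi * t * energyGap p.swap : ℝ) : ℂ) * Complex.I) * 𝓕 φ t)) := by
    intro t
    rw [← schrodingerSymbol_mul_conj t p, ← schrodingerSymbol_mul_conj t p.swap]
    have h1 : ∀ ξ : EuclideanSpace ℝ (Fin n),
        schrodingerSymbol t ξ * (starRingEnd ℂ) (schrodingerSymbol t ξ) = 1 := by
      intro ξ
      rw [Complex.mul_conj', norm_schrodingerSymbol]; simp
    have hk : gagliardoKernel δ (p.2 - p.1) = gagliardoKernel δ (p.1 - p.2) := by
      rw [← gagliardoKernel_neg, neg_sub]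
    simp only [gagliardoEnergy, pairDensity, Prod.fst_swap, Prod.snd_swap, hk]
    push_cast
    rw [← Complex.mul_conj', ← Complex.mul_conj' (g p.1), ← Complex.mul_conj' (g p.2)]
    simp only [map_sub, map_mul, mul_zero, zero_mul, Complex.exp_zero]
    linear_combination (g p.1 * (starRingEnd ℂ) (g p.1) * gagliardoKernel δ (p.1 - p.2) *
      𝓕 φ t) * h1 p.1 + (g p.2 * (starRingEnd ℂ) (g p.2) * gagliardoKernel δ (p.1 - p.2) *
      𝓕 φ t) * h1 p.2
  simp only [hE]
  have hi := fun τ => integrable_exp_mul_fourier φ τ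
  rw [integral_sub ((hi 0).const_mul _) (((hi _).const_mul _).fun_add ((hi _).const_mul _)),
    integral_add ((hi _).const_mul _) ((hi _).const_mul _), integral_const_mul,
    integral_const_mul, integral_const_mul, integral_exp_mul_fourier, integral_exp_mul_fourier,
    integral_exp_mul_fourier, hφ]
  ring

theorem lintegral_gagliardoEnergy {δ : ℝ} (hδ0 : 0 < δ) (hδ1 : δ < 1) (hn : 1 ≤ n) (f : L2E n)
    (t : ℝ) :
    ∫⁻ p, ENNReal.ofReal (gagliardoEnergy δ (𝓕 f : L2E n) t p) =
      ENNReal.ofReal (bConst n δ)⁻¹ * weightedSq δ (schrodingerSolution f t) := by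
  have hb := bConst_pos (n := n) hδ0 hδ1
  rw [weightedSq_schrodingerSolution hδ0 hδ1 hn, ← mul_assoc, ← ENNReal.ofReal_mul (by positivity),
    inv_mul_cancel₀ hb.ne', ENNReal.ofReal_one, one_mul, gagliardoSq]
  refine lintegral_congr fun p => ?_
  rw [gagliardoEnergy, ENNReal.ofReal_mul (by positivity), ENNReal.ofReal_pow (norm_nonneg _),
    ofReal_norm]

@[fun_prop]
theorem measurable_gagliardoEnergy (δ : ℝ) {g : EuclideanSpace ℝ (Fin n) → ℂ}
    (hg : Measurable g) :
    Measurable fun q : ℝ × (EuclideanSpace ℝ (Fin n) × EuclideanSpace ℝ (Fin n)) =>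
      gagliardoEnergy δ g q.1 q.2 := by
  unfold gagliardoEnergy
  fun_prop

theorem integral_hDelta_mul_fourier {δ : ℝ} (hδ0 : 0 < δ) (hδ1 : δ < 1) (hn : 1 ≤ n) {f : L2E n}
    (hf : MemSigma δ f) (φ : 𝓢(ℝ, ℂ)) (hφ : φ 0 = 0)
    (hh : Integrable fun t : ℝ => (hDelta δ f t : ℂ) * 𝓕 φ t)
    (hF : Integrable (hFourierIntegrand δ f φ)) :
    ∫ t : ℝ, (hDelta δ f t : ℂ) * 𝓕 φ t =
      -2 * (bConst n δ : ℂ) * ∫ p, hFourierIntegrand δ f φ p := by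
  have hg := measurable_coeFn_Lp (𝓕 f)
  set g := (𝓕 f : L2E n) with hgdef
  have hb := bConst_pos (n := n) hδ0 hδ1
  have hL := lintegral_gagliardoEnergy hδ0 hδ1 hn f
  rw [← hgdef] at hL
  have hGm := measurable_gagliardoEnergy δ hg
  have hGt : ∀ t, Integrable (gagliardoEnergy δ g t) := by
    intro t
    refine ⟨(hGm.comp measurable_prodMk_left).aestronglyMeasurable, ?_⟩
    rw [hasFiniteIntegral_iff_ofReal (Filter.Eventually.of_forall (gagliardoEnergy_nonneg δ g t)),
      hL t]
    have := (integrable_weight_iff δ (measurable_coeFn_Lp _)).1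
      (integrable_schrodingerSolution hδ0 hδ1 hn hf t)
    finiteness
  have hint : ∀ t, ∫ p, gagliardoEnergy δ g t p = (bConst n δ)⁻¹ * hDelta δ f t := by
    intro t
    rw [integral_eq_lintegral_of_nonneg_ae
      (Filter.Eventually.of_forall (gagliardoEnergy_nonneg δ g t)) (hGt t).1, hL t,
      ENNReal.toReal_mul, ENNReal.toReal_ofReal (by positivity), hDelta_eq_toReal]
  obtain ⟨ψ, hψ⟩ : ∃ ψ : 𝓢(ℝ, ℂ), ψ = 𝓕 φ := ⟨_, rfl⟩
  rw [← hψ] at hh ⊢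
  have hprod : Integrable (Function.uncurry fun (t : ℝ)
      (p : EuclideanSpace ℝ (Fin n) × EuclideanSpace ℝ (Fin n)) =>
      (gagliardoEnergy δ g t p : ℂ) * ψ t) (volume.prod volume) := by
    have hm : Measurable (Function.uncurry fun (t : ℝ)
      (p : EuclideanSpace ℝ (Fin n) × EuclideanSpace ℝ (Fin n)) =>
      (gagliardoEnergy δ g t p : ℂ) * ψ t) := by
      have h1 : Measurable ψ := ψ.continuous.measurable
      exact (Complex.measurable_ofReal.comp hGm).mul (h1.comp measurable_fst)
    rw [integrable_prod_iff hm.aestronglyMeasurable]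
    refine ⟨Filter.Eventually.of_forall fun t => by
      have h : Integrable fun p => (gagliardoEnergy δ g t p : ℂ) := (hGt t).ofReal
      exact h.mul_const (ψ t), ?_⟩
    -- Since the energy is nonnegative, its absolute integral over `p` is again `b⁻¹ h_δ(t)`;
    -- absolute convergence of the pairing in `t` is thus all that Fubini needs.
    refine (hh.norm.const_mul (bConst n δ)⁻¹).congr (Filter.Eventually.of_forall fun t => ?_)
    simp only [Function.uncurry_apply_pair, norm_mul,
      Complex.norm_of_nonneg (gagliardoEnergy_nonneg δ g _ _),
      Complex.norm_of_nonneg (hDelta_nonneg δ f t)]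
    rw [integral_mul_const, hint, mul_assoc]
  have h1 : ∀ t, (hDelta δ f t : ℂ) * ψ t =
      (bConst n δ : ℂ) * ∫ p, (gagliardoEnergy δ g t p : ℂ) * ψ t := by
    intro t
    rw [integral_mul_const, integral_complex_ofReal, hint]
    push_cast
    have : (bConst n δ : ℂ) ≠ 0 := by exact_mod_cast hb.ne'
    field_simp
  simp only [h1]
  rw [integral_const_mul, integral_integral_swap hprod]
  simp only [hψ, integral_gagliardoEnergy_mul_fourier δ g φ hφ]
  have hFe : ∀ p, pairDensity δ g p * φ (energyGap p) = hFourierIntegrand δ f φ p :=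
    fun p => (hFourierIntegrand_eq δ f φ p).symm
  simp only [hFe]
  have hsw : Integrable fun p : EuclideanSpace ℝ (Fin n) × EuclideanSpace ℝ (Fin n) =>
      hFourierIntegrand δ f φ p.swap := hF.swap
  have hsw2 : ∫ p : EuclideanSpace ℝ (Fin n) × EuclideanSpace ℝ (Fin n), hFourierIntegrand δ f φ p.swap = ∫ p, hFourierIntegrand δ f φ p := by
    rw [Measure.volume_eq_prod]
    exact integral_prod_swap _
  rw [integral_neg, integral_add hF hsw, hsw2]
  ring

end Representation

/-! ### The energy gap and Radon–Nikodym densities. -/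

section Density

/-- On `y > 0` the map `y ↦ (y² - c)/2` has the inverse `x ↦ √(2x + c)`, differentiable where `2x +
c > 0`, and differentiable maps of the line send null sets to null sets. -/
theorem volume_setOf_sq_sub_div_two_mem {s : Set ℝ} (hs : volume s = 0) (c : ℝ) :
    volume {y : ℝ | 0 < y ∧ (y ^ 2 - c) / 2 ∈ s} = 0 := by
  have h1 : volume ((fun x => Real.sqrt (2 * x + c)) '' (s ∩ {x | 0 < 2 * x + c})) = 0 := by
    refine addHaar_image_eq_zero_of_differentiableOn_of_addHaar_eq_zero volume ?_
      (measure_mono_null Set.inter_subset_left hs)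
    intro x hx
    have : 2 * x + c ≠ 0 := ne_of_gt hx.2
    have h : DifferentiableAt ℝ (fun x : ℝ => 2 * x + c) x := by fun_prop
    exact (h.sqrt this).differentiableWithinAt
  refine measure_mono_null ?_ h1
  rintro y ⟨hy, hys⟩
  refine ⟨(y ^ 2 - c) / 2, ⟨hys, ?_⟩, ?_⟩
  · have : 0 < y ^ 2 := by positivity
    simp only [Set.mem_ofPred_eq]
    linarith
  · simp only
    rw [show 2 * ((y ^ 2 - c) / 2) + c = y ^ 2 by ring, Real.sqrt_sq hy.le]

/-- Polar coordinates applied to the indicator function reduce to the radial variable. -/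
theorem volume_setOf_norm_sq_sub_div_two_mem {n : ℕ} (hn : 1 ≤ n) {s : Set ℝ}
    (hs : volume s = 0) (c : ℝ) :
    volume {x : EuclideanSpace ℝ (Fin n) | (‖x‖ ^ 2 - c) / 2 ∈ s} = 0 := by
  have : Nonempty (Fin n) := ⟨⟨0, hn⟩⟩
  set F : ℝ → ℝ := fun y => s.indicator (fun _ => (1 : ℝ)) ((y ^ 2 - c) / 2) with hF
  have hF0 : (fun y : ℝ => y ^ (Module.finrank ℝ (EuclideanSpace ℝ (Fin n)) - 1) • F y)
      =ᵐ[volume.restrict (Set.Ioi 0)] 0 := by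
    rw [Filter.EventuallyEq, ae_restrict_iff' measurableSet_Ioi]
    have h := volume_setOf_sq_sub_div_two_mem hs c
    rw [measure_eq_zero_iff_ae_notMem] at h
    filter_upwards [h] with y hy hy0
    have : (y ^ 2 - c) / 2 ∉ s := fun h => hy ⟨hy0, h⟩
    simp [hF, this]
  have hint : Integrable fun x : EuclideanSpace ℝ (Fin n) => F ‖x‖ := by
    rw [integrable_fun_norm_addHaar volume (f := F)]
    exact (integrable_zero _ _ _).congr hF0.symm
  have hzero : ∫ x : EuclideanSpace ℝ (Fin n), F ‖x‖ = 0 := by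
    rw [integral_fun_norm_addHaar volume F, integral_congr_ae hF0]
    simp
  have hnn : ∀ x : EuclideanSpace ℝ (Fin n), 0 ≤ F ‖x‖ := fun x =>
    Set.indicator_nonneg (fun _ _ => zero_le_one) _
  rw [integral_eq_zero_iff_of_nonneg hnn hint] at hzero
  rw [measure_eq_zero_iff_ae_notMem]
  filter_upwards [hzero] with x hx hxs
  have hxs : (‖x‖ ^ 2 - c) / 2 ∈ s := hxs
  simp [hF, hxs] at hx

/-- By Fubini it suffices that each slice with `ξ` fixed is null. -/
theorem map_energyGap_absolutelyContinuous {n : ℕ} (hn : 1 ≤ n) :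
    (volume : Measure (EuclideanSpace ℝ (Fin n) × EuclideanSpace ℝ (Fin n))).map energyGap ≪
      volume := by
  refine Measure.AbsolutelyContinuous.mk fun s hsm hs => ?_
  rw [Measure.map_apply measurable_energyGap hsm, Measure.volume_eq_prod,
    Measure.measure_prod_null (measurable_energyGap hsm)]
  refine Filter.Eventually.of_forall fun ξ => ?_
  exact volume_setOf_norm_sq_sub_div_two_mem hn hs (‖ξ‖ ^ 2)

variable {α : Type*} [MeasurableSpace α] {μ : Measure α} [SFinite μ] {Φ : α → ℝ}

theorem exists_density_of_map_absolutelyContinuous (hΦ : Measurable Φ) (hac : μ.map Φ ≪ volume)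
    (D : α → ENNReal) :
    ∃ G : ℝ → ENNReal, Measurable G ∧ (μ.withDensity D).map Φ = volume.withDensity G := by
  have h1 : (μ.withDensity D).map Φ ≪ volume :=
    ((withDensity_absolutelyContinuous μ D).map hΦ).trans hac
  exact ⟨_, Measure.measurable_rnDeriv _ volume, (Measure.withDensity_rnDeriv_eq _ _ h1).symm⟩

/-- The density `d` is not assumed integrable on the whole space, only over preimages `Φ ⁻¹' s`.
Hence `g` is chosen before `s`, so that one function serves all cutoffs; the Radon–Nikodym density
may be infinite elsewhere, but it is finite almost everywhere on `s`. -/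
theorem exists_real_density (hΦ : Measurable Φ) (hac : μ.map Φ ≪ volume)
    {d : α → ℝ} (hd : Measurable d) (hd0 : ∀ x, 0 ≤ d x) :
    ∃ g : ℝ → ℝ, ∀ s : Set ℝ, MeasurableSet s → IntegrableOn d (Φ ⁻¹' s) μ →
      IntegrableOn g s ∧ ∫ τ in s, ‖g τ‖ = ∫ x in Φ ⁻¹' s, d x ∂μ ∧
      ∀ φ : ℝ → ℂ, Measurable φ → (∀ τ ∉ s, φ τ = 0) →
        ∫ τ, (g τ : ℂ) * φ τ = ∫ x, (d x : ℂ) * φ (Φ x) ∂μ := by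
  have hdm : Measurable fun x => ENNReal.ofReal (d x) := by fun_prop
  obtain ⟨G, hG, hGeq⟩ := exists_density_of_map_absolutelyContinuous hΦ hac fun x => ENNReal.ofReal (d x)
  refine ⟨fun τ => (G τ).toReal, fun s hs hds => ?_⟩
  have hl : ∫⁻ τ in s, G τ = ∫⁻ x in Φ ⁻¹' s, ENNReal.ofReal (d x) ∂μ := by
    rw [← withDensity_apply _ hs, ← hGeq, Measure.map_apply hΦ hs, withDensity_apply _ (hΦ hs)]
  have hlt : ∫⁻ τ in s, G τ ≠ ⊤ := by
    rw [hl, ← ofReal_integral_eq_lintegral_ofReal hds (Filter.Eventually.of_forall hd0)]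
    exact ENNReal.ofReal_ne_top
  have hGlt : ∀ᵐ τ ∂(volume.restrict s), G τ < ⊤ := ae_lt_top hG hlt
  refine ⟨integrable_toReal_of_lintegral_ne_top hG.aemeasurable hlt, ?_, fun φ hφm hφ => ?_⟩
  · simp only [Real.norm_of_nonneg ENNReal.toReal_nonneg]
    rw [integral_toReal hG.aemeasurable hGlt, hl,
      integral_eq_lintegral_of_nonneg_ae (Filter.Eventually.of_forall hd0) hd.aestronglyMeasurable]
  · have e1 : ∫ τ, ((G τ).toReal : ℂ) * φ τ = ∫ τ in s, ((G τ).toReal : ℂ) * φ τ :=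
      (setIntegral_eq_integral_of_forall_compl_eq_zero fun τ hτ => by rw [hφ τ hτ, mul_zero]).symm
    have e2 : ∫ x, (d x : ℂ) * φ (Φ x) ∂μ = ∫ x in Φ ⁻¹' s, (d x : ℂ) * φ (Φ x) ∂μ :=
      (setIntegral_eq_integral_of_forall_compl_eq_zero fun x hx => by
        rw [hφ _ hx, mul_zero]).symm
    have e3 : ∫ τ in s, φ τ ∂((μ.withDensity fun x => ENNReal.ofReal (d x)).map Φ) =
        ∫ τ in s, φ τ ∂(volume.withDensity G) := by rw [hGeq]
    rw [setIntegral_map hs hφm.aestronglyMeasurable hΦ.aemeasurable,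
      restrict_withDensity (hΦ hs), restrict_withDensity hs,
      integral_withDensity_eq_integral_toReal_smul hdm (by simp),
      integral_withDensity_eq_integral_toReal_smul hG hGlt] at e3
    rw [e1, e2]
    simp only [ENNReal.toReal_ofReal (hd0 _), Complex.real_smul] at e3
    exact e3.symm

theorem exists_complex_density (hΦ : Measurable Φ) (hac : μ.map Φ ≪ volume)
    {D : α → ℂ} (hD : Measurable D) :
    ∃ g : ℝ → ℂ, ∀ s : Set ℝ, MeasurableSet s → IntegrableOn D (Φ ⁻¹' s) μ →
      IntegrableOn g s ∧ ∫ τ in s, ‖g τ‖ ≤ 4 * ∫ x in Φ ⁻¹' s, ‖D x‖ ∂μ ∧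
      ∀ φ : ℝ → ℂ, Measurable φ → (∃ M, ∀ τ, ‖φ τ‖ ≤ M) → (∀ τ ∉ s, φ τ = 0) →
        ∫ τ, g τ * φ τ = ∫ x, D x * φ (Φ x) ∂μ := by
  -- For `i = 0, 1, 2, 3` these are the positive parts of `Re D`, `Im D`, `-Re D`, `-Im D`. Each is
  -- at most `|D|`, which accounts for the factor `4`.
  set d : Fin 4 → α → ℝ := fun i x => max (((-Complex.I) ^ (i : ℕ) * D x).re) 0 with hd
  have hdm : ∀ i, Measurable (d i) := fun i =>
    (Complex.measurable_re.comp (hD.const_mul _)).max measurable_const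
  have hdle : ∀ i x, ‖d i x‖ ≤ ‖D x‖ := by
    intro i x
    rw [Real.norm_of_nonneg (le_max_right _ _)]
    refine max_le ((Complex.re_le_norm _).trans ?_) (norm_nonneg _)
    simp
  have hsum : ∀ x, D x = ∑ i : Fin 4, Complex.I ^ (i : ℕ) * (d i x : ℂ) := by
    intro x
    have h : ∀ y : ℝ, max y 0 - max (-y) 0 = y := fun y => by
      rcases le_total 0 y with h | h
      · rw [max_eq_left h, max_eq_right (by linarith), sub_zero]
      · rw [max_eq_right h, max_eq_left (by linarith)]; ring
    have hre := h (D x).re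
    have him := h (D x).im
    have e2 : (-Complex.I) ^ 2 = -1 := by rw [neg_sq, Complex.I_sq]
    have e3 : (-Complex.I) ^ 3 = Complex.I := by
      rw [pow_succ, e2]; ring
    have e4 : Complex.I ^ 3 = -Complex.I := by rw [pow_succ, Complex.I_sq]; ring
    simp only [hd, Fin.sum_univ_four, Fin.val_zero, Fin.val_one, Fin.val_two, pow_zero, pow_one,
      one_mul, show ((3 : Fin 4) : ℕ) = 3 from rfl, e2, e3, e4, Complex.I_sq]
    apply Complex.ext
    · simp
      linarith
    · simp
      linarith
  choose g hg using fun i => exists_real_density hΦ hac (hdm i) fun x => le_max_right _ _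
  refine ⟨fun τ => ∑ i : Fin 4, Complex.I ^ (i : ℕ) * (g i τ : ℂ), fun s hs hDs => ?_⟩
  have hdi : ∀ i : Fin 4, IntegrableOn (d i) (Φ ⁻¹' s) μ := fun i =>
    hDs.norm.mono' (hdm i).aestronglyMeasurable (Filter.Eventually.of_forall (hdle i))
  have hgi : ∀ i : Fin 4, IntegrableOn (fun τ => Complex.I ^ (i : ℕ) * (g i τ : ℂ)) s := fun i =>
    Integrable.const_mul ((hg i s hs (hdi i)).1.ofReal) _
  refine ⟨integrable_finsetSum _ fun i _ => hgi i, ?_, ?_⟩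
  · calc ∫ τ in s, ‖∑ i : Fin 4, Complex.I ^ (i : ℕ) * (g i τ : ℂ)‖
        ≤ ∫ τ in s, ∑ i : Fin 4, ‖g i τ‖ := by
          refine integral_mono (integrable_finsetSum _ fun i _ => hgi i).norm
            (integrable_finsetSum _ fun i _ => (hg i s hs (hdi i)).1.norm) fun τ => ?_
          refine (norm_sum_le _ _).trans (Finset.sum_le_sum fun i _ => ?_)
          simp
      _ = ∑ i : Fin 4, ∫ τ in s, ‖g i τ‖ :=
          integral_finsetSum _ fun i _ => (hg i s hs (hdi i)).1.norm
      _ ≤ ∑ _i : Fin 4, ∫ x in Φ ⁻¹' s, ‖D x‖ ∂μ := by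
          refine Finset.sum_le_sum fun i _ => ?_
          rw [(hg i s hs (hdi i)).2.1]
          exact integral_mono (hdi i) hDs.norm fun x => (le_abs_self _).trans (hdle i x)
      _ = _ := by simp
  · rintro φ hφm ⟨M, hM⟩ hφ
    have hL : ∀ i : Fin 4, Integrable fun τ => Complex.I ^ (i : ℕ) * ((g i τ : ℂ) * φ τ) := by
      intro i
      have h1 : IntegrableOn (fun τ => Complex.I ^ (i : ℕ) * (g i τ : ℂ) * φ τ) s :=
        Integrable.mul_bdd (hgi i) hφm.aestronglyMeasurable (Filter.Eventually.of_forall hM)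
      simp only [mul_assoc] at h1
      exact h1.integrable_of_forall_notMem_eq_zero fun τ hτ => by rw [hφ τ hτ]; simp
    have hR : ∀ i : Fin 4, Integrable (fun x => Complex.I ^ (i : ℕ) * ((d i x : ℂ) * φ (Φ x))) μ := by
      intro i
      have h0 : IntegrableOn (fun x => (d i x : ℂ)) (Φ ⁻¹' s) μ := (hdi i).ofReal
      have h1 : IntegrableOn (fun x => (d i x : ℂ) * φ (Φ x)) (Φ ⁻¹' s) μ :=
        Integrable.mul_bdd h0 (hφm.comp hΦ).aestronglyMeasurable
          (Filter.Eventually.of_forall fun x => hM (Φ x))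
      exact (h1.integrable_of_forall_notMem_eq_zero fun x hx => by
        rw [hφ _ hx, mul_zero]).const_mul _
    simp only [hsum, Finset.sum_mul, mul_assoc]
    rw [integral_finsetSum _ fun i _ => hL i, integral_finsetSum _ fun i _ => hR i]
    refine Finset.sum_congr rfl fun i _ => ?_
    rw [integral_const_mul, integral_const_mul, (hg i s hs (hdi i)).2.2 φ hφm hφ]

end Density

/-! ### Assembly of the theorem. -/

theorem integrableOn_pairDensity {n : ℕ} {δ a : ℝ} {f : L2E n} {C : ENNReal} (hC : C ≠ ⊤)
    (hf : MemSigma δ f)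
    (h : ∫⁻ p in {p | a ≤ |energyGap p|}, ‖pairDensity δ (𝓕 f : L2E n) p‖ₑ ≤ C * sigmaSq δ f) :
    IntegrableOn (pairDensity δ (𝓕 f : L2E n)) {p | a ≤ |energyGap p|} ∧
      ∫ p in {p | a ≤ |energyGap p|}, ‖pairDensity δ (𝓕 f : L2E n) p‖ ≤
        C.toReal * sigmaNormSq δ f := by
  have hm := measurable_pairDensity δ (measurable_coeFn_Lp (𝓕 f))
  have hS := hf.sigmaSq_ne_top
  have htop : C * sigmaSq δ f ≠ ⊤ := by finiteness
  refine ⟨⟨hm.aestronglyMeasurable, h.trans_lt htop.lt_top⟩, ?_⟩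
  rw [integral_norm_eq_lintegral_enorm hm.aestronglyMeasurable, ← hf.toReal_sigmaSq,
    ← ENNReal.toReal_mul]
  exact ENNReal.toReal_mono htop h

theorem mainTheorem5 (n : ℕ) (hn : 1 ≤ n) (δ : ℝ) (hδ0 : 0 < δ) (hδ1 : δ < 1) :
    ∃ C : ℝ → ℝ, ∀ f : Lp ℂ 2 (volume : Measure (EuclideanSpace ℝ (Fin n))), MemSigma δ f →
      -- `h_δ[f]` is finite everywhere and is a tempered distribution `H`
      (∀ t : ℝ, Integrable (fun x : EuclideanSpace ℝ (Fin n) =>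
        ‖x‖ ^ (2 * δ) * ‖schrodingerSolution f t x‖ ^ 2)) ∧
      ∃ H : 𝓢'(ℝ, ℂ), IsDistributionOf (hDelta δ f) H ∧
        -- the representation of `𝓕 H` away from the origin
        (∀ a : ℝ, 0 < a → ∀ φ : 𝓢(ℝ, ℂ), (∀ τ ∈ Set.Ioo (-a) a, φ τ = 0) →
          Integrable (hFourierIntegrand δ f φ) ∧
          𝓕 H φ = -2 * (bConst n δ : ℂ) *
            ∫ p : EuclideanSpace ℝ (Fin n) × EuclideanSpace ℝ (Fin n),
              hFourierIntegrand δ f φ p) ∧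
        -- the bound of `𝓕 H` by the supremum norm of the test function
        (∀ a : ℝ, 0 < a → ∀ φ : 𝓢(ℝ, ℂ), (∀ τ ∈ Set.Ioo (-a) a, φ τ = 0) →
          ‖𝓕 H φ‖ ≤ C a * sigmaNormSq δ f * ‖φ.toBoundedContinuousFunction‖) ∧
        -- away from the origin `𝓕 H` is a function `g`, with the bound in `L¹(ℝ ∖ [-a, a])`
        ∃ g : ℝ → ℂ, ∀ a : ℝ, 0 < a →
          IntegrableOn g (Set.Icc (-a) a)ᶜ ∧
          (∀ φ : 𝓢(ℝ, ℂ), (∀ τ ∈ Set.Ioo (-a) a, φ τ = 0) → 𝓕 H φ = ∫ τ : ℝ, g τ * φ τ) ∧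
          (∫ τ in (Set.Icc (-a) a)ᶜ, ‖g τ‖) ≤ C a * sigmaNormSq δ f := by
  obtain ⟨K, hK, hKle⟩ := exists_lintegral_pairDensity_le (n := n) hδ0 hδ1 hn
  have hb := bConst_pos (n := n) hδ0 hδ1
  have hcoef : ‖(-2 * (bConst n δ : ℂ))‖ = 2 * bConst n δ := by
    rw [norm_mul, norm_neg, Complex.norm_of_nonneg hb.le]
    simp
  -- `8 = 2 · 4`: the prefactor `2b` of the representation times the loss in
  -- `exists_complex_density`. The sup-norm bound alone would need only `2`.
  refine ⟨fun a => 8 * bConst n δ * (K a).toReal, fun f hf => ⟨fun t =>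
    integrable_schrodingerSolution hδ0 hδ1 hn hf t, ?_⟩⟩
  obtain ⟨C, hC⟩ := exists_hDelta_le hδ0 hδ1 hn hf
  obtain ⟨H, hH⟩ := exists_isDistributionOf (measurable_hDelta hδ0 hδ1 hn f) (hDelta_nonneg δ f) hC
  have hσ : 0 ≤ sigmaNormSq δ f := by rw [← hf.toReal_sigmaSq]; exact ENNReal.toReal_nonneg
  have hDm := measurable_pairDensity δ (measurable_coeFn_Lp (𝓕 f))
  have hD := fun a ha => integrableOn_pairDensity (hK a) hf (hKle a ha f)
  have hsm : ∀ a : ℝ, MeasurableSet {τ : ℝ | a ≤ |τ|} := fun a =>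
    measurableSet_le measurable_const (by fun_prop)
  have hsupp : ∀ (a : ℝ) (φ : 𝓢(ℝ, ℂ)), (∀ τ ∈ Set.Ioo (-a) a, φ τ = 0) →
      ∀ τ ∉ {τ : ℝ | a ≤ |τ|}, φ τ = 0 := fun a φ hφ τ hτ =>
    hφ τ (abs_lt.1 (not_le.1 hτ))
  have hbd : ∀ (φ : 𝓢(ℝ, ℂ)) (τ : ℝ), ‖φ τ‖ ≤ ‖φ.toBoundedContinuousFunction‖ := fun φ τ =>
    φ.toBoundedContinuousFunction.norm_coe_le_norm τ
  have hFeq : ∀ φ : 𝓢(ℝ, ℂ), hFourierIntegrand δ f φ =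
      fun p => pairDensity δ (𝓕 f : L2E n) p * φ (energyGap p) := fun φ =>
    funext fun p => hFourierIntegrand_eq δ f φ p
  have hφm : ∀ φ : 𝓢(ℝ, ℂ), Measurable φ := fun φ => φ.continuous.measurable
  have hFon : ∀ a, 0 < a → ∀ φ : 𝓢(ℝ, ℂ), IntegrableOn (hFourierIntegrand δ f φ)
      {p | a ≤ |energyGap p|} := by
    intro a ha φ
    rw [hFeq]
    exact Integrable.mul_bdd (hD a ha).1 ((hφm φ).comp measurable_energyGap).aestronglyMeasurable
      (Filter.Eventually.of_forall fun p => hbd φ _)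
  have hFzero : ∀ (a : ℝ) (φ : 𝓢(ℝ, ℂ)), (∀ τ ∈ Set.Ioo (-a) a, φ τ = 0) →
      ∀ p ∉ {p : EuclideanSpace ℝ (Fin n) × EuclideanSpace ℝ (Fin n) | a ≤ |energyGap p|},
        hFourierIntegrand δ f φ p = 0 := by
    intro a φ hφ p hp
    rw [hFeq]
    simp only [hsupp a φ hφ _ hp, mul_zero]
  have hFint : ∀ a, 0 < a → ∀ φ : 𝓢(ℝ, ℂ), (∀ τ ∈ Set.Ioo (-a) a, φ τ = 0) →
      Integrable (hFourierIntegrand δ f φ) := fun a ha φ hφ =>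
    (hFon a ha φ).integrable_of_forall_notMem_eq_zero (hFzero a φ hφ)
  have hrep : ∀ a, 0 < a → ∀ φ : 𝓢(ℝ, ℂ), (∀ τ ∈ Set.Ioo (-a) a, φ τ = 0) →
      𝓕 H φ = -2 * (bConst n δ : ℂ) * ∫ p, hFourierIntegrand δ f φ p := by
    intro a ha φ hφ
    rw [TemperedDistribution.fourier_apply, (hH _).2]
    exact integral_hDelta_mul_fourier hδ0 hδ1 hn hf φ (hφ 0 ⟨by linarith, ha⟩) (hH _).1
      (hFint a ha φ hφ)
  refine ⟨H, hH, fun a ha φ hφ => ⟨hFint a ha φ hφ, hrep a ha φ hφ⟩, fun a ha φ hφ => ?_, ?_⟩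
  · rw [hrep a ha φ hφ, norm_mul, hcoef]
    set M := ‖φ.toBoundedContinuousFunction‖ with hM
    have h1 : ‖∫ p, hFourierIntegrand δ f φ p‖ ≤ (K a).toReal * sigmaNormSq δ f * M := by
      rw [← setIntegral_eq_integral_of_forall_compl_eq_zero (hFzero a φ hφ)]
      calc _ ≤ ∫ p in {p | a ≤ |energyGap p|}, ‖pairDensity δ (𝓕 f : L2E n) p‖ * M := by
            refine norm_integral_le_of_norm_le ((hD a ha).1.norm.mul_const M)
              (Filter.Eventually.of_forall fun p => ?_)
            rw [hFeq, norm_mul]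
            gcongr
            exact hbd φ _
        _ ≤ _ := by
            rw [integral_mul_const]
            exact mul_le_mul_of_nonneg_right (hD a ha).2 (norm_nonneg _)
    have h2 : 0 ≤ (K a).toReal * sigmaNormSq δ f * M := by positivity
    calc 2 * bConst n δ * ‖∫ p, hFourierIntegrand δ f φ p‖
        ≤ 2 * bConst n δ * ((K a).toReal * sigmaNormSq δ f * M) := by gcongr
      _ ≤ 8 * bConst n δ * ((K a).toReal * sigmaNormSq δ f * M) := by gcongr; norm_num
      _ = _ := by ring
  · obtain ⟨g, hg⟩ := exists_complex_density measurable_energyGap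
      (map_energyGap_absolutelyContinuous hn) hDm
    refine ⟨fun τ => -2 * (bConst n δ : ℂ) * g τ, fun a ha => ?_⟩
    obtain ⟨hg1, hg2, hg3⟩ := hg {τ | a ≤ |τ|} (hsm a) (hD a ha).1
    -- Test functions vanish only on the open interval, so the pairing uses the closed set `a ≤
    -- |τ|`; the `L¹` bound is then restricted to the smaller complement.
    have hsub : (Set.Icc (-a) a)ᶜ ⊆ {τ : ℝ | a ≤ |τ|} := fun τ hτ =>
      le_of_not_gt fun h : |τ| < a => hτ (abs_le.1 h.le)
    refine ⟨(Integrable.const_mul hg1 _).mono_measure (Measure.restrict_mono_set _ hsub),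
      fun φ hφ => ?_, ?_⟩
    · rw [hrep a ha φ hφ, hFeq]
      simp only [mul_assoc]
      rw [integral_const_mul, integral_const_mul,
        hg3 φ (hφm φ) ⟨_, hbd φ⟩ (hsupp a φ hφ)]
    · have h1 : ∫ τ in (Set.Icc (-a) a)ᶜ, ‖g τ‖ ≤ 4 * ((K a).toReal * sigmaNormSq δ f) := by
        refine (setIntegral_mono_set hg1.norm (Filter.Eventually.of_forall fun τ => norm_nonneg _)
          hsub.eventuallyLE).trans (hg2.trans ?_)
        gcongr
        exact (hD a ha).2
      simp only [norm_mul _ (g _), hcoef]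
      rw [integral_const_mul]
      calc 2 * bConst n δ * ∫ τ in (Set.Icc (-a) a)ᶜ, ‖g τ‖
          ≤ 2 * bConst n δ * (4 * ((K a).toReal * sigmaNormSq δ f)) := by gcongr
        _ = _ := by ring
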